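/- Let $n\ge 1$ be an integer. An $n\times n$ alternating sign matrix (ASM) is a matrix $B=(b_{i,j})_{1\le i,j\le n}$ with entries in $\{0,1,-1\}$ whose row and column sums are all $1$ and whose partial row sums $\sum_{k\le j} b_{i,k}$ and partial column sums $\sum_{k\le i} b_{k,j}$ all lie in $\{0,1\}$ (equivalently, the nonzero entries of each row and column alternate in sign and sum to $1$). Put $$\mathrm{Inv}(B)=\sum_{\substack{1\le i<j\le n\\ 1\le k<\ell\le n}} b_{i,\ell}\,b_{j,k},$$ let $N(B)$ be the number of entries of $B$ equal to $-1$, and let $t(B)$ be the number of entries $0$ to the left of the unique $1$ in the top row of $B$. (One has $\mathrm{Inv}(B)\ge N(B)$.) For elements $x,y,z$ of a field $K$ let $$Z^{(n)}_{ASM}(x,y,z)=\sum_{B\ n\times n\text{ ASM}} z^{t(B)}\,y^{\mathrm{Inv}(B)-N(B)}\,x^{N(B)}.$$ **Theorem.** Let $K$ be a field, let $x,y,z,\nu\in K$ with $x\neq 0$, $\nu\ne 0$ and $$x\,\nu(1-\nu)=\nu+y(1-\nu).$$ Let $M'_{ASM}=(m_{i,j})_{i,j\ge 0}$ be the infinite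 matrix over $K$ (depending on $n$) whose double generating function $f_{M'_{ASM}}(u,v)=\sum_{i,j\ge 0} m_{i,j}u^iv^j$ is the formal power series $$f_{M'_{ASM}}(u,v)=\frac{1-\nu}{1-uv}+\frac{\nu}{1-xu-v-(y-x)uv}+\frac{\nu(z-1)}{1-(y(z-1)+x)u}\left(1+\frac{yu}{1-xu}\right)^{n}v^{n-1}\left(1+\frac{v}{x}\,\frac{y(\nu-1)+\nu(xu-1)}{\nu+(y-\nu x)u}\right).$$ Then $$(1+\nu(z-1))\,Z^{(n)}_{ASM}(x,y,z)=\det\,(m_{i,j})_{0\le i,j\le n-1}.$$ -/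

import Mathlib

namespace RefinedASM

section Combinatorics

variable {n : ℕ}

/-- Alternating sign matrices: entries in `{0, 1, -1}`, all partial sums of rows (from the left)
and of columns (from the top) equal to `0` or `1`, all row and column sums equal to `1`.
The condition on the partial sums says that the nonzero entries of each line alternate in sign,
beginning with `1`. -/
structure IsASM (B : Matrix (Fin n) (Fin n) ℤ) : Prop where
  entries : ∀ i j, B i j = 0 ∨ B i j = 1 ∨ B i j = -1
  row_partial : ∀ i j, (∑ k ∈ Finset.Iic j, B i k) = 0 ∨ (∑ k ∈ Finset.Iic j, B i k) = 1
  col_partial : ∀ i j, (∑ k ∈ Finset.Iic i, B k j) = 0 ∨ (∑ k ∈ Finset.Iic i, B k j) = 1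
  row_sum : ∀ i, ∑ j, B i j = 1
  col_sum : ∀ j, ∑ i, B i j = 1

theorem isASM_iff (B : Matrix (Fin n) (Fin n) ℤ) : IsASM B ↔
    (∀ i j, B i j = 0 ∨ B i j = 1 ∨ B i j = -1) ∧
    (∀ i j, (∑ k ∈ Finset.Iic j, B i k) = 0 ∨ (∑ k ∈ Finset.Iic j, B i k) = 1) ∧
    (∀ i j, (∑ k ∈ Finset.Iic i, B k j) = 0 ∨ (∑ k ∈ Finset.Iic i, B k j) = 1) ∧
    (∀ i, ∑ j, B i j = 1) ∧ (∀ j, ∑ i, B i j = 1) :=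
  ⟨fun h => ⟨h.1, h.2, h.3, h.4, h.5⟩, fun h => ⟨h.1, h.2.1, h.2.2.1, h.2.2.2.1, h.2.2.2.2⟩⟩

instance : DecidablePred (IsASM (n := n)) := fun B =>
  have : Decidable (∀ i j, B i j = 0 ∨ B i j = 1 ∨ B i j = -1) :=
    @Nat.decidableForallFin _ _ fun i =>
      Nat.decidableForallFin fun j => B i j = 0 ∨ B i j = 1 ∨ B i j = -1
  decidable_of_iff' _ (isASM_iff B)

/-- The finite set of all `n × n` alternating sign matrices. -/
def asmFinset (n : ℕ) : Finset (Matrix (Fin n) (Fin n) ℤ) :=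
  Finset.filter IsASM
    ((Fintype.piFinset fun _ : Fin n => Fintype.piFinset fun _ : Fin n =>
      ({0, 1, -1} : Finset ℤ)).map Matrix.of.toEmbedding)

theorem mem_asmFinset (B : Matrix (Fin n) (Fin n) ℤ) : B ∈ asmFinset n ↔ IsASM B := by
  unfold asmFinset
  rw [Finset.mem_filter]
  refine ⟨fun h => h.2, fun h => ⟨?_, h⟩⟩
  refine Finset.mem_map.2 ⟨fun i j => B i j, ?_, rfl⟩
  simp only [Fintype.mem_piFinset, Finset.mem_insert, Finset.mem_singleton]
  exact h.entries

/-- The inversion number `Inv(B)`: the sum of `B i l * B j k` over `i < j` and `k < l`. -/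
def inversions (B : Matrix (Fin n) (Fin n) ℤ) : ℤ :=
  ∑ i, ∑ j ∈ Finset.Ioi i, ∑ k, ∑ l ∈ Finset.Ioi k, B i l * B j k

/-- `N(B)`: the number of entries equal to `-1`. -/
def negOnes (B : Matrix (Fin n) (Fin n) ℤ) : ℕ :=
  (Finset.univ.filter fun p : Fin n × Fin n => B p.1 p.2 = -1).card

/-- `t(B)`: the number of entries `0` to the left of the entry `1` in the top row. -/
def topZeros [NeZero n] (B : Matrix (Fin n) (Fin n) ℤ) : ℕ :=
  (Finset.univ.filter fun j : Fin n => B 0 j = 0 ∧ ∃ k, j < k ∧ B 0 k = 1).card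

/-- `Inv(B) - N(B)` is nonnegative for an alternating sign matrix, so that `y ^ (Inv(B) - N(B))`
may be written with the natural number `(Inv(B) - N(B)).toNat` as exponent. -/
theorem negOnes_le_inversions {B : Matrix (Fin n) (Fin n) ℤ} (hB : IsASM B) :
    (negOnes B : ℤ) ≤ inversions B := by
  have hinv : inversions B =
      ∑ i, ∑ k, (∑ l ∈ Finset.Ioi k, B i l) * (∑ j ∈ Finset.Ioi i, B j k) := by
    unfold inversions
    refine Finset.sum_congr rfl fun i _ => ?_
    rw [Finset.sum_comm]
    refine Finset.sum_congr rfl fun k _ => ?_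
    rw [Finset.sum_comm, Finset.sum_mul_sum]
  have hsplit : ∀ (f : Fin n → ℤ) (k : Fin n),
      ∑ l ∈ Finset.Iic k, f l + ∑ l ∈ Finset.Ioi k, f l = ∑ l, f l := by
    intro f k
    have h : Finset.Ioi k = (Finset.Iic k)ᶜ := by ext l; simp
    rw [h, Finset.sum_add_sum_compl]
  have hsplit' : ∀ (f : Fin n → ℤ) (k : Fin n),
      ∑ l ∈ Finset.Iic k, f l = f k + ∑ l ∈ Finset.Iio k, f l := by
    intro f k
    rw [← Finset.Iio_insert, Finset.sum_insert (by simp)]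
  have hlow : ∀ (f : Fin n → ℤ),
      (∀ j, (∑ k ∈ Finset.Iic j, f k) = 0 ∨ (∑ k ∈ Finset.Iic j, f k) = 1) → ∀ k,
      0 ≤ ∑ l ∈ Finset.Iio k, f l ∧ ∑ l ∈ Finset.Iio k, f l ≤ 1 := by
    intro f hf k
    rcases Nat.eq_zero_or_pos k.val with h0 | h0
    · have : Finset.Iio k = ∅ := by
        ext l; simp [Fin.lt_def, h0]
      simp [this]
    · have : Finset.Iio k = Finset.Iic (⟨k.val - 1, by omega⟩ : Fin n) := by
        ext l; simp only [Finset.mem_Iio, Finset.mem_Iic, Fin.lt_def, Fin.le_def]; omega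
      rw [this]
      rcases hf ⟨k.val - 1, by omega⟩ with h | h <;> rw [h] <;> norm_num
  have hneg : (negOnes B : ℤ) = ∑ i, ∑ k, if B i k = -1 then (1 : ℤ) else 0 := by
    unfold negOnes
    rw [Finset.card_filter, Fintype.sum_prod_type]
    push_cast
    rfl
  rw [hinv, hneg]
  refine Finset.sum_le_sum fun i _ => Finset.sum_le_sum fun k _ => ?_
  have r1 : ∑ l ∈ Finset.Iic k, B i l + ∑ l ∈ Finset.Ioi k, B i l = ∑ l, B i l := hsplit _ k
  have c1 : ∑ l ∈ Finset.Iic i, B l k + ∑ l ∈ Finset.Ioi i, B l k = ∑ l, B l k :=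
    hsplit (fun l => B l k) i
  have r2 : ∑ l ∈ Finset.Iic k, B i l = B i k + ∑ l ∈ Finset.Iio k, B i l := hsplit' _ k
  have c2 : ∑ l ∈ Finset.Iic i, B l k = B i k + ∑ l ∈ Finset.Iio i, B l k :=
    hsplit' (fun l => B l k) i
  have r3 : 0 ≤ ∑ l ∈ Finset.Iio k, B i l ∧ ∑ l ∈ Finset.Iio k, B i l ≤ 1 :=
    hlow _ (hB.row_partial i) k
  have c3 : 0 ≤ ∑ l ∈ Finset.Iio i, B l k ∧ ∑ l ∈ Finset.Iio i, B l k ≤ 1 :=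
    hlow (fun l => B l k) (fun j => hB.col_partial j k) i
  have r4 := hB.row_partial i k
  have c4 := hB.col_partial i k
  have r5 := hB.row_sum i
  have c5 := hB.col_sum k
  split_ifs with h
  · have e1 : ∑ l ∈ Finset.Ioi k, B i l = 1 := by omega
    have e2 : ∑ l ∈ Finset.Ioi i, B l k = 1 := by omega
    rw [e1, e2]; norm_num
  · exact mul_nonneg (by omega) (by omega)

/-- The partition function `Z_ASM^(n)(x, y, z)`, the sum of `z^t(B) y^(Inv(B) - N(B)) x^N(B)`
over all `n × n` alternating sign matrices `B`. -/
def partitionFunction {K : Type*} [Field K] (n : ℕ) [NeZero n] (x y z : K) : K :=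
  ∑ B ∈ asmFinset n,
    z ^ topZeros B * y ^ (inversions B - (negOnes B : ℤ)).toNat * x ^ negOnes B

end Combinatorics

section GeneratingFunctions

variable {K : Type*} [Field K]

/-- The double generating function `∑ M i j u^i v^j` of an infinite matrix, as a formal power
series in the two variables `u = X 0` and `v = X 1`. -/
def doubleGenFun (M : Matrix ℕ ℕ K) : MvPowerSeries (Fin 2) K := fun d => M (d 0) (d 1)

/-- The infinite matrix with a given double generating function. -/
noncomputable def matrixOfGenFun (f : MvPowerSeries (Fin 2) K) : Matrix ℕ ℕ K :=
  Matrix.of fun i j => MvPowerSeries.coeff (Finsupp.single 0 i + Finsupp.single 1 j) f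

theorem doubleGenFun_matrixOfGenFun (f : MvPowerSeries (Fin 2) K) :
    doubleGenFun (matrixOfGenFun f) = f := by
  ext d
  have h : (Finsupp.single 0 (d 0) + Finsupp.single 1 (d 1) : Fin 2 →₀ ℕ) = d := by
    ext i; fin_cases i <;> simp
  change MvPowerSeries.coeff _ f = MvPowerSeries.coeff d f
  rw [h]

theorem matrixOfGenFun_doubleGenFun (M : Matrix ℕ ℕ K) :
    matrixOfGenFun (doubleGenFun M) = M := by
  ext i j
  change M ((Finsupp.single 0 i + Finsupp.single 1 j : Fin 2 →₀ ℕ) 0)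
    ((Finsupp.single 0 i + Finsupp.single 1 j : Fin 2 →₀ ℕ) 1) = M i j
  have h0 : (Finsupp.single 0 i + Finsupp.single 1 j : Fin 2 →₀ ℕ) 0 = i := by simp
  have h1 : (Finsupp.single 0 i + Finsupp.single 1 j : Fin 2 →₀ ℕ) 1 = j := by simp
  rw [h0, h1]

/-- The explicit double generating function of the modified matrix. Fractions are inverses of
formal power series; the denominators have constant term `1`, except
`ν + (y - ν x) u`, whose constant term is `ν`. -/
noncomputable def modifiedGenFun (n : ℕ) (x y z ν : K) : MvPowerSeries (Fin 2) K :=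
  let u : MvPowerSeries (Fin 2) K := MvPowerSeries.X 0
  let v : MvPowerSeries (Fin 2) K := MvPowerSeries.X 1
  let C : K → MvPowerSeries (Fin 2) K := fun c => MvPowerSeries.C c
  C (1 - ν) * (1 - u * v)⁻¹
    + C ν * (1 - C x * u - v - C (y - x) * u * v)⁻¹
    + C (ν * (z - 1)) * (1 - C (y * (z - 1) + x) * u)⁻¹
      * (1 + C y * u * (1 - C x * u)⁻¹) ^ n * v ^ (n - 1)
      * (1 + v * C x⁻¹ * (C (y * (ν - 1)) + C ν * (C x * u - 1))
          * (C ν + C (y - ν * x) * u)⁻¹)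

/-- The modified, `n`-dependent infinite matrix `M'_ASM`. -/
noncomputable def modifiedMatrix (n : ℕ) (x y z ν : K) : Matrix ℕ ℕ K :=
  matrixOfGenFun (modifiedGenFun n x y z ν)

/-- The truncation of an infinite matrix to its `n` first rows and columns. -/
def truncation (n : ℕ) (M : Matrix ℕ ℕ K) : Matrix (Fin n) (Fin n) K :=
  Matrix.of fun i j => M i j

end GeneratingFunctions

end RefinedASM

/-! An alternating sign matrix is a state of the six-vertex model with domain wall boundary: the
partial sums along its rows and columns are the states of the edges. `vertexWeight` attaches
parameters u to the columns and v to the rows. At u = v = 0 a vertex weighs y if its four edges are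
0, x if the entry is -1, and 1 otherwise. The vertices of the first kind number Inv - N. If the top
row has v = V instead, each zero to the right of the top 1 gains a factor 1 - V
(`dwPartition_eq_sum_statistics`).

The Yang–Baxter equation makes the row transfer matrices commute, so the partition function is
symmetric in v. Together with a degree bound and a recursion at u v = 1, this gives the
Izergin–Korepin formula `dwPartition_mul_det_vandermonde`: the partition function times two
Vandermonde determinants is an explicit product times det(1/(a b)), with a, b the weights `aWeight`,
`bWeight`.

The equation for ν says that the series f = (1-ν)/b + ν/a (`baseGenFun`) equals a product of a
function of u and a function of v, divided by a b (`baseGenFun_mul`). So det f(u_i, v_j) is the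
Izergin–Korepin determinant up to elementary factors. Reading off the coefficient of ∏ u_i^i v_j^j,
with an extra power l of the last v, removes the Vandermonde determinants. It shows that
(1-(1-ν)V)(1-V)^(-n) times the partition function with one free row parameter V is the generating
function in V of determinants of coefficients of f whose last column is n-1+l
(`exists_powerSeries_coeff_eq_det`).

Finally put z = 1/(1-V). Summing the last column over l is a geometric series and gives the last
column of the modified matrix, while the prefactors combine to 1 + ν(z-1) (`refined_unitGeom`). Both
sides are polynomials in z and 1/(1-V) is transcendental over K, so the identity holds for every z
(`refined_formula`). -/

namespace RefinedASM

/-! ### Six-vertex weights and commuting transfer matrices -/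

section SixVertex

variable {R : Type*} [CommRing R]

/-- The weight `1 - u v`. -/
def bWeight (u v : R) : R := 1 - u * v

/-- The weight `1 - x u - v - (y - x) u v`. -/
def aWeight (x y u v : R) : R := 1 - x * u - v - (y - x) * u * v

/-- The weight of a vertex with state `s` on the edge above, `s'` below, `h` on the left and `h'`
on the right. -/
def vertexWeight (x y u v : R) : Bool → Bool → Bool → Bool → R
  | false, false, false, false => y * bWeight u v
  | true, true, true, true => bWeight u v
  | false, false, true, true => aWeight x y u v
  | true, true, false, false => aWeight x y u v
  | false, true, false, true => 1
  | true, false, true, false =>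
      (1 - (1 + x - y) * u + x * u ^ 2) * (x - (1 + x - y) * v + v ^ 2)
  | _, _, _, _ => 0

/-- The vertex weights with fixed vertical states, as a matrix in the horizontal states. -/
def vertexMatrix (x y u v : R) (s s' : Bool) : Matrix Bool Bool R :=
  Matrix.of fun h h' => vertexWeight x y u v s s' h h'

/-- The monodromy matrix of a row with parameter `v`, with vertical states `t` above and `t'`
below. -/
def rowMatrix {n : ℕ} (x y : R) (u : Fin n → R) (v : R) (t t' : Fin n → Bool) :
    Matrix Bool Bool R :=
  (List.ofFn fun j => vertexMatrix x y (u j) v (t j) (t' j)).prod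

/-- The row transfer matrix with domain wall boundary conditions on the left and on the right. -/
def rowTransfer {n : ℕ} (x y : R) (u : Fin n → R) (v : R) :
    Matrix (Fin n → Bool) (Fin n → Bool) R :=
  Matrix.of fun t t' => rowMatrix x y u v t t' false true

/-- The partition function of the six-vertex model with domain wall boundary conditions, with
column parameters `u` and a list of row parameters. -/
def dwPartition {n : ℕ} (x y : R) (u : Fin n → R) (vs : List R) : R :=
  (vs.map (rowTransfer x y u)).prod (fun _ => false) (fun _ => true)

theorem sum_fin_succ_arrow {n : ℕ} {M α : Type*} [AddCommMonoid M] [Fintype α]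
    (F : (Fin (n + 1) → α) → M) :
    ∑ t, F t = ∑ b, ∑ s : Fin n → α, F (Fin.cons b s) := by
  rw [← (Fin.consEquiv fun _ : Fin (n + 1) => α).sum_comp, Fintype.sum_prod_type]
  rfl

theorem rowMatrix_cons {n : ℕ} (x y u₀ v : R) (u : Fin n → R) (s s' : Bool)
    (t t' : Fin n → Bool) :
    rowMatrix x y (Fin.cons u₀ u : Fin (n + 1) → R) v (Fin.cons s t : Fin (n + 1) → Bool)
        (Fin.cons s' t' : Fin (n + 1) → Bool) =
      vertexMatrix x y u₀ v s s' * rowMatrix x y u v t t' := by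
  simp [rowMatrix, List.ofFn_succ]

/-- Two vertices on top of each other, with the intermediate vertical state summed out. -/
def doubleVertex (x y u v v' : R) (s s'' : Bool) : Matrix (Bool × Bool) (Bool × Bool) R :=
  Matrix.of fun p q => ∑ s', vertexWeight x y u v s s' p.1 q.1 *
    vertexWeight x y u v' s' s'' p.2 q.2

/-- The matrix that intertwines two rows. -/
def crossing (x y v v' : R) : Matrix (Bool × Bool) (Bool × Bool) R :=
  Matrix.of fun p q => match p, q with
    | (false, false), (false, false) => x - (x - y) * v - v' + v * v'
    | (true, true), (true, true) => x - (x - y) * v - v' + v * v'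
    | (false, true), (false, true) => x - (1 + x - y) * v + v ^ 2
    | (true, false), (true, false) => x - (1 + x - y) * v' + v' ^ 2
    | (true, false), (false, true) => y * (v - v')
    | (false, true), (true, false) => v - v'
    | _, _ => 0

set_option maxHeartbeats 2000000 in
/-- The Yang–Baxter equation. -/
theorem crossing_mul_doubleVertex (x y u v v' : R) (s s'' : Bool) :
    crossing x y v v' * doubleVertex x y u v v' s s'' =
      doubleVertex x y u v' v s s'' * crossing x y v v' := by
  ext ⟨p, p'⟩ ⟨q, q'⟩
  cases s <;> cases s'' <;> cases p <;> cases p' <;> cases q <;> cases q' <;>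
  simp only [Matrix.mul_apply, crossing, doubleVertex, Matrix.of_apply, Fintype.sum_prod_type,
    Fintype.sum_bool, vertexWeight, aWeight, bWeight, mul_zero, zero_mul, add_zero, zero_add] <;>
  ring

theorem sum_rowMatrix_mul_rowMatrix {n : ℕ} (x y v v' : R) (u : Fin n → R)
    (t t'' : Fin n → Bool) (p q : Bool × Bool) :
    ∑ t', rowMatrix x y u v t t' p.1 q.1 * rowMatrix x y u v' t' t'' p.2 q.2 =
      (List.ofFn fun j => doubleVertex x y (u j) v v' (t j) (t'' j)).prod p q := by
  induction n generalizing p q with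
  | zero =>
    simp only [rowMatrix, List.ofFn_zero, List.prod_nil, Matrix.one_apply, Finset.univ_unique,
      Finset.sum_const, Finset.card_singleton, one_smul, Prod.ext_iff, ite_and, ite_mul, one_mul,
      zero_mul]
  | succ n ih =>
    obtain ⟨s, t, rfl⟩ : ∃ s r, t = Fin.cons s r := ⟨_, _, (Fin.cons_self_tail t).symm⟩
    obtain ⟨s'', t'', rfl⟩ : ∃ s r, t'' = Fin.cons s r := ⟨_, _, (Fin.cons_self_tail t'').symm⟩
    obtain ⟨u₀, u, rfl⟩ : ∃ s r, u = Fin.cons s r := ⟨_, _, (Fin.cons_self_tail u).symm⟩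
    simp only [List.ofFn_succ, List.prod_cons, Fin.cons_zero, Fin.cons_succ, Matrix.mul_apply,
      ← ih, sum_fin_succ_arrow, rowMatrix_cons]
    simp only [doubleVertex, Matrix.of_apply, vertexMatrix, Fintype.sum_prod_type,
      Fintype.sum_bool, Finset.mul_sum, ← Finset.sum_add_distrib]
    refine Finset.sum_congr rfl fun t' _ => ?_
    ring

theorem crossing_mul_prod {n : ℕ} (x y v v' : R) (u : Fin n → R) (t t'' : Fin n → Bool) :
    crossing x y v v' * (List.ofFn fun j => doubleVertex x y (u j) v v' (t j) (t'' j)).prod =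
      (List.ofFn fun j => doubleVertex x y (u j) v' v (t j) (t'' j)).prod *
        crossing x y v v' := by
  induction n with
  | zero => simp
  | succ n ih =>
    have := ih (fun j => u j.succ) (fun j => t j.succ) (fun j => t'' j.succ)
    simp only [List.ofFn_succ, List.prod_cons]
    rw [← mul_assoc, crossing_mul_doubleVertex, mul_assoc, this, mul_assoc]

/-- On the states (false, false) and (true, true) the crossing acts by one and the same scalar. The
entry of the intertwining relation between these two boundary states is therefore the commutation
relation times that scalar, which is cancelled. -/
theorem rowTransfer_mul_comm [IsDomain R] {n : ℕ} (x y v v' : R) (u : Fin n → R)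
    (h : x - (x - y) * v - v' + v * v' ≠ 0) :
    rowTransfer x y u v * rowTransfer x y u v' = rowTransfer x y u v' * rowTransfer x y u v := by
  ext t t''
  have key := congrFun (congrFun (crossing_mul_prod x y v v' u t t'') (false, false)) (true, true)
  have e1 := sum_rowMatrix_mul_rowMatrix x y v v' u t t'' (false, false) (true, true)
  have e2 := sum_rowMatrix_mul_rowMatrix x y v' v u t t'' (false, false) (true, true)
  simp only [Matrix.mul_apply, crossing, Matrix.of_apply, Fintype.sum_prod_type,
    Fintype.sum_bool, mul_zero, zero_mul, add_zero, zero_add, ← e1, ← e2] at key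
  rw [mul_comm (∑ _, _)] at key
  simpa only [Matrix.mul_apply, rowTransfer, Matrix.of_apply] using mul_left_cancel₀ h key

end SixVertex

theorem fin_cons_const {α : Type*} {n : ℕ} (b : α) :
    (fun _ : Fin (n + 1) => b) = (Fin.cons b fun _ => b : Fin (n + 1) → α) := by
  ext j; cases j using Fin.cases <;> rfl

/-! ### Recursion of the partition function when one weight b vanishes -/

section Recursion

variable {R : Type*} [CommRing R] {n : ℕ} (x y u₀ v : R) (u : Fin n → R)

theorem rowTransfer_cons_apply (s s' : Bool) (t t' : Fin n → Bool) :
    rowTransfer x y (Fin.cons u₀ u : Fin (n + 1) → R) v (Fin.cons s t : Fin (n + 1) → Bool)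
        (Fin.cons s' t' : Fin (n + 1) → Bool) =
      ∑ m, vertexWeight x y u₀ v s s' false m * rowMatrix x y u v t t' m true := by
  rw [rowTransfer, Matrix.of_apply, rowMatrix_cons, Matrix.mul_apply]
  rfl

theorem rowTransfer_cons_false_false (t t' : Fin n → Bool) :
    rowTransfer x y (Fin.cons u₀ u : Fin (n + 1) → R) v (Fin.cons false t : Fin (n + 1) → Bool)
        (Fin.cons false t' : Fin (n + 1) → Bool) =
      y * bWeight u₀ v * rowTransfer x y u v t t' := by
  rw [rowTransfer_cons_apply]
  simp [vertexWeight, rowTransfer]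

theorem rowTransfer_cons_false_true (t t' : Fin n → Bool) :
    rowTransfer x y (Fin.cons u₀ u : Fin (n + 1) → R) v (Fin.cons false t : Fin (n + 1) → Bool)
        (Fin.cons true t' : Fin (n + 1) → Bool) = rowMatrix x y u v t t' true true := by
  simp [rowTransfer_cons_apply, vertexWeight]

theorem rowTransfer_cons_true_false (t t' : Fin n → Bool) :
    rowTransfer x y (Fin.cons u₀ u : Fin (n + 1) → R) v (Fin.cons true t : Fin (n + 1) → Bool)
        (Fin.cons false t' : Fin (n + 1) → Bool) = 0 := by
  simp [rowTransfer_cons_apply, vertexWeight]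

theorem rowTransfer_cons_true_true (t t' : Fin n → Bool) :
    rowTransfer x y (Fin.cons u₀ u : Fin (n + 1) → R) v (Fin.cons true t : Fin (n + 1) → Bool)
        (Fin.cons true t' : Fin (n + 1) → Bool) =
      aWeight x y u₀ v * rowTransfer x y u v t t' := by
  rw [rowTransfer_cons_apply]
  simp [vertexWeight, rowTransfer]

/-- The product of the row transfer matrices for a list of row parameters. -/
def transferProd (x y : R) (u : Fin n → R) (vs : List R) :
    Matrix (Fin n → Bool) (Fin n → Bool) R :=
  (vs.map (rowTransfer x y u)).prod

theorem transferProd_nil : transferProd x y u [] = 1 := rfl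

theorem transferProd_cons (vs : List R) :
    transferProd x y u (v :: vs) = rowTransfer x y u v * transferProd x y u vs := by
  simp [transferProd]

theorem transferProd_cons_true_true (vs : List R) (t t' : Fin n → Bool) :
    transferProd x y (Fin.cons u₀ u : Fin (n + 1) → R) vs (Fin.cons true t : Fin (n + 1) → Bool)
        (Fin.cons true t' : Fin (n + 1) → Bool) =
      (vs.map (aWeight x y u₀)).prod * transferProd x y u vs t t' := by
  induction vs generalizing t with
  | nil => simp [transferProd_nil, Matrix.one_apply, Fin.cons_inj]
  | cons v vs ih =>
    simp only [transferProd_cons, Matrix.mul_apply, sum_fin_succ_arrow, ih, Fintype.sum_bool,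
      rowTransfer_cons_true_false, rowTransfer_cons_true_true, List.map_cons, List.prod_cons,
      zero_mul, Finset.sum_const_zero, add_zero, Finset.mul_sum]
    exact Finset.sum_congr rfl fun s _ => by ring

/-- With all upper edges false, a state true entering from the left can only go straight on, so the
row is frozen. -/
theorem rowMatrix_false_true_true (t' : Fin n → Bool) :
    rowMatrix x y u v (fun _ => false) t' true true =
      if t' = fun _ => false then ∏ j, aWeight x y (u j) v else 0 := by
  induction n with
  | zero => simp [rowMatrix, Subsingleton.elim t' fun _ => false]
  | succ n ih =>
    obtain ⟨s, t', rfl⟩ : ∃ s r, t' = Fin.cons s r := ⟨_, _, (Fin.cons_self_tail t').symm⟩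
    obtain ⟨u₀, u, rfl⟩ : ∃ s r, u = Fin.cons s r := ⟨_, _, (Fin.cons_self_tail u).symm⟩
    rw [fin_cons_const false, rowMatrix_cons, Matrix.mul_apply, Fintype.sum_bool, ih]
    cases s <;> simp [vertexMatrix, vertexWeight, Fin.cons_inj, Fin.prod_univ_succ]

/-- A vanishing b forces an entry 1 in the top left corner. This freezes the rest of the first row
and of the first column into vertices of weight a, and leaves a smaller domain wall model. -/
theorem dwPartition_cons_of_bWeight_eq_zero (vs : List R) (h : bWeight u₀ v = 0) :
    dwPartition x y (Fin.cons u₀ u : Fin (n + 1) → R) (v :: vs) =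
      (vs.map (aWeight x y u₀)).prod * (∏ j, aWeight x y (u j) v) * dwPartition x y u vs := by
  change transferProd x y _ (v :: vs) _ _ = _ * transferProd x y u vs _ _
  rw [transferProd_cons, Matrix.mul_apply, sum_fin_succ_arrow, Fintype.sum_bool,
    fin_cons_const false, fin_cons_const true]
  simp only [rowTransfer_cons_false_true, rowTransfer_cons_false_false, h, mul_zero, zero_mul,
    Finset.sum_const_zero, add_zero, transferProd_cons_true_true, rowMatrix_false_true_true,
    ite_mul, Finset.sum_ite_eq', Finset.mem_univ, if_true]
  ring

theorem dwPartition_perm [IsDomain R] {vs ws : List R} (hp : vs.Perm ws)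
    (h : vs.Pairwise fun v v' => x - (x - y) * v - v' + v * v' ≠ 0) :
    dwPartition x y u vs = dwPartition x y u ws := by
  unfold dwPartition
  rw [(hp.map (rowTransfer x y u)).prod_eq']
  rw [List.pairwise_map]
  exact h.imp fun hvv => rowTransfer_mul_comm x y _ _ u hvv

end Recursion

/-! ### Polynomial functions of bounded degree -/

section PolynomialFunctions

variable {L : Type*} [Field L]

open Polynomial in
/-- The functions given by polynomials of degree less than `k`. -/
noncomputable def polyFun (L : Type*) [Field L] (k : ℕ) : Submodule L (L → L) :=
  (degreeLT L k).map (LinearMap.pi fun t : L => leval t)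

theorem mem_polyFun {k : ℕ} {f : L → L} :
    f ∈ polyFun L k ↔ ∃ P : Polynomial L, P.degree < k ∧ ∀ t, P.eval t = f t := by
  simp only [polyFun, Submodule.mem_map, Polynomial.mem_degreeLT, funext_iff]
  rfl

theorem mul_mem_polyFun {k l : ℕ} {f g : L → L} (hf : f ∈ polyFun L (k + 1))
    (hg : g ∈ polyFun L l) : (fun t => f t * g t) ∈ polyFun L (k + l) := by
  obtain ⟨P, hP, hPf⟩ := mem_polyFun.1 hf
  obtain ⟨Q, hQ, hQg⟩ := mem_polyFun.1 hg
  refine mem_polyFun.2 ⟨P * Q, ?_, fun t => by rw [Polynomial.eval_mul, hPf, hQg]⟩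
  rcases eq_or_ne P 0 with rfl | hP0
  · simp
  rcases eq_or_ne Q 0 with rfl | hQ0
  · simp
  rw [Polynomial.degree_mul, Polynomial.degree_eq_natDegree hP0,
    Polynomial.degree_eq_natDegree hQ0] at *
  norm_cast at *
  omega

theorem const_mem_polyFun (c : L) : (fun _ => c) ∈ polyFun L 1 :=
  mem_polyFun.2 ⟨Polynomial.C c, lt_of_le_of_lt Polynomial.degree_C_le (by norm_num), by simp⟩

theorem affine_mem_polyFun (c d : L) : (fun t => c + d * t) ∈ polyFun L 2 :=
  mem_polyFun.2 ⟨Polynomial.C d * Polynomial.X + Polynomial.C c,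
    lt_of_le_of_lt Polynomial.degree_linear_le (by norm_num), fun t => by simp [add_comm]⟩

theorem prod_mem_polyFun {ι : Type*} (s : Finset ι) (k : ℕ) (f : ι → L → L)
    (hf : ∀ i ∈ s, f i ∈ polyFun L (k + 1)) :
    (fun t => ∏ i ∈ s, f i t) ∈ polyFun L (s.card * k + 1) := by
  classical
  induction s using Finset.induction_on with
  | empty => simpa using const_mem_polyFun (1 : L)
  | insert i s hi ih =>
    simp only [Finset.prod_insert hi, Finset.card_insert_of_notMem hi]
    have := mul_mem_polyFun (hf i (by simp)) (ih fun j hj => hf j (by simp [hj]))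
    convert this using 2
    ring

theorem eq_zero_of_mem_polyFun {ι : Type*} [Fintype ι] {k : ℕ} {f : L → L}
    (hf : f ∈ polyFun L k) (p : ι → L) (hp : Function.Injective p) (hk : k ≤ Fintype.card ι)
    (h0 : ∀ i, f (p i) = 0) (t : L) : f t = 0 := by
  obtain ⟨P, hP, hPf⟩ := mem_polyFun.1 hf
  have : P = 0 := Polynomial.eq_zero_of_degree_lt_of_eval_index_eq_zero (v := p)
    (s := Finset.univ) hp.injOn (lt_of_lt_of_le hP (Nat.cast_le.2 hk)) fun i _ => by rw [hPf, h0]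
  rw [← hPf, this, Polynomial.eval_zero]

end PolynomialFunctions

/-! ### The Izergin–Korepin determinant -/

section IzerginKorepin

variable {L : Type*} [Field L] {n : ℕ} (x y : L)

theorem bWeight_mem_polyFun (v : L) : (fun t => bWeight t v) ∈ polyFun L 2 := by
  convert affine_mem_polyFun 1 (-v) using 2
  unfold bWeight; ring

theorem aWeight_mem_polyFun (v : L) : (fun t => aWeight x y t v) ∈ polyFun L 2 := by
  convert affine_mem_polyFun (1 - v) (-(x + (y - x) * v)) using 2
  unfold aWeight; ring

/-- The edges of the first column change from false to true exactly once and never back, because the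
left boundary is false. The row where this happens contributes a constant in `u₀`, every other row a
factor of degree at most 1; hence degree below the number of rows. -/
theorem transferProd_mem_polyFun (u : Fin n → L) (vs : List L) (t t' : Fin n → Bool) :
    (fun u₀ => transferProd x y (Fin.cons u₀ u : Fin (n + 1) → L) vs
      (Fin.cons false t : Fin (n + 1) → Bool) (Fin.cons true t' : Fin (n + 1) → Bool)) ∈
      polyFun L vs.length := by
  induction vs generalizing t with
  | nil =>
    simp only [transferProd_nil, Matrix.one_apply, Fin.cons_inj, Bool.false_eq_true, false_and,
      if_false]
    exact Submodule.zero_mem _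
  | cons v vs ih =>
    simp only [transferProd_cons, Matrix.mul_apply, sum_fin_succ_arrow, Fintype.sum_bool,
      rowTransfer_cons_false_true, rowTransfer_cons_false_false, transferProd_cons_true_true,
      List.length_cons]
    refine Submodule.add_mem _ ?_ ?_
    -- The column turns in the present row: all later vertices of the column have weight a.
    · have : ∀ l : List L, (fun u₀ => (l.map (aWeight x y u₀)).prod) ∈
          polyFun L (l.length + 1) := by
        intro l
        induction l with
        | nil => simpa using const_mem_polyFun (1 : L)
        | cons w l ih =>
          simp only [List.map_cons, List.prod_cons, List.length_cons]
          convert mul_mem_polyFun (aWeight_mem_polyFun x y w) ih using 2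
          ring
      simp only [mul_left_comm _ (List.prod _)]
      convert Submodule.smul_mem _ (∑ s, rowMatrix x y u v t s true true *
        transferProd x y u vs s t') (this vs) using 1
      ext u₀
      simp [Finset.mul_sum, mul_comm]
    -- The column stays false in the present row, at the cost of one factor b.
    · convert Submodule.sum_mem _ (t := Finset.univ) (fun s (_ : s ∈ Finset.univ) =>
        mul_mem_polyFun (bWeight_mem_polyFun v)
        (Submodule.smul_mem _ (y * rowTransfer x y u v t s) (ih s))) using 1
      · rw [add_comm]
      · funext u₀
        rw [Finset.sum_apply]
        refine Finset.sum_congr rfl fun s _ => ?_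
        simp only [Pi.smul_apply, smul_eq_mul]
        ring

theorem dwPartition_mem_polyFun (u : Fin n → L) (vs : List L) :
    (fun u₀ => dwPartition x y (Fin.cons u₀ u : Fin (n + 1) → L) vs) ∈ polyFun L vs.length := by
  have h := transferProd_mem_polyFun x y u vs (fun _ => false) (fun _ => true)
  simp only [← fin_cons_const] at h
  exact h

/-- The Izergin–Korepin matrix. -/
noncomputable def ikMatrix {m : ℕ} (u : Fin m → L) (v : Fin n → L) : Matrix (Fin m) (Fin n) L :=
  Matrix.of fun i j => (aWeight x y (u i) (v j) * bWeight (u i) (v j))⁻¹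

/-- The Izergin–Korepin matrix with first row multiplied by its common denominator, which
makes it polynomial in the first column parameter `t`. -/
noncomputable def ikPolyMatrix (u : Fin n → L) (v : Fin (n + 1) → L) (t : L) :
    Matrix (Fin (n + 1)) (Fin (n + 1)) L :=
  Matrix.of fun i j => Fin.cases
    (∏ k ∈ Finset.univ.erase j, aWeight x y t (v k) * bWeight t (v k))
    (fun i => ikMatrix x y u v i j) i

theorem ikPolyMatrix_zero (u : Fin n → L) (v : Fin (n + 1) → L) (t : L) (j : Fin (n + 1)) :
    ikPolyMatrix x y u v t 0 j =
      ∏ k ∈ Finset.univ.erase j, aWeight x y t (v k) * bWeight t (v k) := rfl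

theorem ikPolyMatrix_succ (u : Fin n → L) (v : Fin (n + 1) → L) (t : L) (i : Fin n)
    (j : Fin (n + 1)) :
    ikPolyMatrix x y u v t i.succ j = (aWeight x y (u i) (v j) * bWeight (u i) (v j))⁻¹ := rfl

/-- The difference of the two sides of the Izergin–Korepin formula, with denominators cleared in
the first row. -/
noncomputable def ikDefect (u : Fin n → L) (v : Fin (n + 1) → L) (t : L) : L :=
  dwPartition x y (Fin.cons t u : Fin (n + 1) → L) (List.ofFn v) *
      ((Matrix.vandermonde (Fin.cons t u : Fin (n + 1) → L)).det * (Matrix.vandermonde v).det) -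
    (∏ i, ∏ j, aWeight x y (u i) (v j) * bWeight (u i) (v j)) * (ikPolyMatrix x y u v t).det

theorem det_vandermonde_cons (u : Fin n → L) (t : L) :
    (Matrix.vandermonde (Fin.cons t u : Fin (n + 1) → L)).det =
      (∏ i, (u i - t)) * (Matrix.vandermonde u).det := by
  rw [Matrix.det_vandermonde, Matrix.det_vandermonde, Fin.prod_univ_succ]
  congr 1
  · simp
  · simp [Fin.prod_Ioi_succ]

/-- In the first term the partition function has degree at most n and the Vandermonde factor degree
n. In the second, each entry of the first row is a product of n quadratic factors. So 2n + 1 zeros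
suffice. -/
theorem ikDefect_mem_polyFun (u : Fin n → L) (v : Fin (n + 1) → L) :
    ikDefect x y u v ∈ polyFun L (2 * n + 1) := by
  refine Submodule.sub_mem _ ?_ ?_
  · simp only [det_vandermonde_cons]
    have h1 := dwPartition_mem_polyFun x y u (List.ofFn v)
    rw [List.length_ofFn] at h1
    have h2 := prod_mem_polyFun Finset.univ 1 (fun i t => u i - t) fun i _ => by
      simpa [sub_eq_add_neg] using affine_mem_polyFun (u i) (-1)
    have h3 := Submodule.smul_mem _ ((Matrix.vandermonde u).det * (Matrix.vandermonde v).det)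
      (mul_mem_polyFun h1 h2)
    rw [Finset.card_univ, Fintype.card_fin, mul_one, ← add_assoc, ← two_mul] at h3
    convert h3 using 1
    funext t
    simp only [Pi.smul_apply, smul_eq_mul]
    ring
  · have h : ∀ j, (fun t => ∏ k ∈ Finset.univ.erase j, aWeight x y t (v k) * bWeight t (v k)) ∈
        polyFun L (2 * n + 1) := by
      intro j
      have := prod_mem_polyFun (Finset.univ.erase j) 2
        (fun k t => aWeight x y t (v k) * bWeight t (v k)) fun k _ => by
          simpa using mul_mem_polyFun (aWeight_mem_polyFun x y (v k)) (bWeight_mem_polyFun (v k))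
      simpa [mul_comm] using this
    convert Submodule.sum_mem _ (t := Finset.univ) (fun (j : Fin (n + 1)) (_ : j ∈ Finset.univ) =>
        Submodule.smul_mem _ ((∏ i, ∏ j, aWeight x y (u i) (v j) * bWeight (u i) (v j)) *
          ((-1) ^ (j : ℕ) * ((ikMatrix x y u v).submatrix id j.succAbove).det)) (h j)) using 1
    funext t
    rw [Finset.sum_apply, Matrix.det_succ_row_zero, Finset.mul_sum]
    refine Finset.sum_congr rfl fun j _ => ?_
    have : (ikPolyMatrix x y u v t).submatrix Fin.succ j.succAbove =
        (ikMatrix x y u v).submatrix id j.succAbove := by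
      ext i k; rfl
    rw [this, ikPolyMatrix_zero, Pi.smul_apply, smul_eq_mul]
    ring

/-- Both terms are antisymmetric in `v`: the partition function is symmetric by commutation of the
transfer matrices, and the Vandermonde and Izergin–Korepin determinants change by the sign. -/
theorem ikDefect_comp_perm (u : Fin n → L) (v : Fin (n + 1) → L) (t : L)
    (σ : Equiv.Perm (Fin (n + 1)))
    (h : ∀ i j, i ≠ j → x - (x - y) * v i - v j + v i * v j ≠ 0) :
    ikDefect x y u (v ∘ σ) t = Equiv.Perm.sign σ * ikDefect x y u v t := by
  have h1 : dwPartition x y (Fin.cons t u : Fin (n + 1) → L) (List.ofFn v) =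
      dwPartition x y (Fin.cons t u : Fin (n + 1) → L) (List.ofFn (v ∘ σ)) := by
    refine dwPartition_perm x y _ (σ.ofFn_comp_perm v).symm ?_
    rw [List.pairwise_ofFn]
    exact fun i j hij => h i j hij.ne
  have h2 : (Matrix.vandermonde (v ∘ σ)).det =
      Equiv.Perm.sign σ * (Matrix.vandermonde v).det := by
    rw [← Matrix.det_permute]; rfl
  have h3 : (ikPolyMatrix x y u (v ∘ σ) t).det =
      Equiv.Perm.sign σ * (ikPolyMatrix x y u v t).det := by
    rw [← Matrix.det_permute']
    congr 1
    ext i j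
    cases i using Fin.cases with
    | zero =>
      simp only [ikPolyMatrix_zero, Matrix.submatrix_apply, id]
      refine Finset.prod_bij (fun k _ => σ k) ?_ ?_ ?_ ?_
      · simp
      · simp
      · intro k hk; exact ⟨σ.symm k, by simpa [Equiv.symm_apply_eq] using hk, by simp⟩
      · simp
    | succ i => rfl
  have h4 : ∀ i, ∏ j, aWeight x y (u i) ((v ∘ σ) j) * bWeight (u i) ((v ∘ σ) j) =
      ∏ j, aWeight x y (u i) (v j) * bWeight (u i) (v j) := fun i =>
    Equiv.prod_comp σ fun j => aWeight x y (u i) (v j) * bWeight (u i) (v j)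
  simp only [ikDefect, ← h1, h2, h3, h4]
  ring

theorem ikDefect_eq_zero_of_mul_eq_one (u : Fin n → L) (v : Fin (n + 1) → L) (t : L)
    (ht : t * v 0 = 1)
    (ih : dwPartition x y u (List.ofFn fun k => v (Fin.succ k)) *
      ((Matrix.vandermonde u).det * (Matrix.vandermonde fun k => v (Fin.succ k)).det) =
      (∏ i, ∏ j : Fin n, aWeight x y (u i) (v j.succ) * bWeight (u i) (v j.succ)) *
        (ikMatrix x y u fun k => v (Fin.succ k)).det) :
    ikDefect x y u v t = 0 := by
  have hb : bWeight t (v 0) = 0 := by rw [bWeight, ht, sub_self]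
  have hdet : (ikPolyMatrix x y u v t).det =
      (∏ k : Fin n, aWeight x y t (v k.succ) * bWeight t (v k.succ)) *
        (ikMatrix x y u fun k => v (Fin.succ k)).det := by
    -- In the first row only column 0 survives: every other entry contains the factor `bWeight t (v
    -- 0) = 0`.
    rw [Matrix.det_succ_row_zero, Fin.sum_univ_succ, Finset.sum_eq_zero, add_zero]
    · have : (ikPolyMatrix x y u v t).submatrix Fin.succ (Fin.succAbove 0) =
          ikMatrix x y u fun k => v (Fin.succ k) := by
        ext i k; rfl
      have he : Finset.univ.erase (0 : Fin (n + 1)) = Finset.univ.map (Fin.succEmb n) := by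
        ext k; cases k using Fin.cases <;> simp
      rw [this, ikPolyMatrix_zero, he, Finset.prod_map]
      simp
    · intro j _
      rw [ikPolyMatrix_zero, Finset.prod_eq_zero (i := 0)
        (by simp [(Fin.succ_ne_zero j).symm]) (by rw [hb, mul_zero])]
      simp
  have hv : v = Fin.cons (v 0) fun k => v (Fin.succ k) := (Fin.cons_self_tail v).symm
  -- As `t * v 0 = 1`, one has (u - t)(v' - v₀) = (1 - u v₀)(1 - t v') for all u and v'. The
  -- Vandermonde factors thus match the b factors, after pairing `u i` with `v i.succ`.
  have hprod : (∏ i, (u i - t)) * ∏ k : Fin n, (v k.succ - v 0) =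
      (∏ i, bWeight (u i) (v 0)) * ∏ k : Fin n, bWeight t (v k.succ) := by
    rw [← Finset.prod_mul_distrib, ← Finset.prod_mul_distrib]
    refine Finset.prod_congr rfl fun i _ => ?_
    unfold bWeight
    linear_combination (1 - u i * v i.succ) * ht
  have hvv : (Matrix.vandermonde v).det = (∏ k : Fin n, (v k.succ - v 0)) *
      (Matrix.vandermonde fun k => v (Fin.succ k)).det := by
    conv_lhs => rw [hv]
    rw [det_vandermonde_cons]
  rw [ikDefect, hdet, det_vandermonde_cons, hvv, List.ofFn_succ,
    dwPartition_cons_of_bWeight_eq_zero _ _ _ _ _ _ hb, List.map_ofFn, List.prod_ofFn]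
  simp only [Fin.prod_univ_succ (n := n), Finset.prod_mul_distrib] at ih ⊢
  simp only [Function.comp_def]
  linear_combination (∏ k : Fin n, aWeight x y t (v k.succ)) * (∏ i, aWeight x y (u i) (v 0)) *
    ((∏ i, bWeight (u i) (v 0)) * ∏ k : Fin n, bWeight t (v k.succ)) * ih +
    (∏ k : Fin n, aWeight x y t (v k.succ)) * (∏ i, aWeight x y (u i) (v 0)) *
     dwPartition x y u (List.ofFn fun k => v (Fin.succ k)) *
      (Matrix.vandermonde u).det * (Matrix.vandermonde fun k => v (Fin.succ k)).det * hprod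

/-- At `t = u i` two Vandermonde rows coincide, and the first row of `ikPolyMatrix` becomes a
multiple of row `i.succ`. -/
theorem ikDefect_apply_self (u : Fin n → L) (v : Fin (n + 1) → L) (i : Fin n)
    (h : ∀ j, aWeight x y (u i) (v j) * bWeight (u i) (v j) ≠ 0) :
    ikDefect x y u v (u i) = 0 := by
  have h1 : (Matrix.vandermonde (Fin.cons (u i) u : Fin (n + 1) → L)).det = 0 := by
    rw [det_vandermonde_cons, Finset.prod_eq_zero (Finset.mem_univ i) (sub_self _), zero_mul]
  have h2 : (ikPolyMatrix x y u v (u i)).det = 0 := by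
    set c := ∏ k, aWeight x y (u i) (v k) * bWeight (u i) (v k)
    have : ikPolyMatrix x y u v (u i) = (ikPolyMatrix x y u v (u i)).updateRow 0
        (c • (ikPolyMatrix x y u v (u i)) i.succ) := by
      ext k j
      cases k using Fin.cases with
      | zero =>
        rw [Matrix.updateRow_self, Pi.smul_apply, smul_eq_mul, ikPolyMatrix_zero,
          ikPolyMatrix_succ, eq_mul_inv_iff_mul_eq₀ (h j),
          Finset.prod_erase_mul _ _ (Finset.mem_univ j)]
      | succ k => rw [Matrix.updateRow_ne (Fin.succ_ne_zero k)]
    rw [this, Matrix.det_updateRow_smul, Matrix.det_updateRow_eq_zero (Fin.succ_ne_zero i),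
      mul_zero]
  rw [ikDefect, h1, h2]
  ring

/-- The Izergin–Korepin determinant formula. -/
theorem dwPartition_mul_det_vandermonde (u v : Fin n → L) (hu : Function.Injective u)
    (hv : Function.Injective v) (hv0 : ∀ j, v j ≠ 0)
    (ha : ∀ i j, aWeight x y (u i) (v j) ≠ 0) (hb : ∀ i j, bWeight (u i) (v j) ≠ 0)
    (h : ∀ i j, i ≠ j → x - (x - y) * v i - v j + v i * v j ≠ 0) :
    dwPartition x y u (List.ofFn v) * ((Matrix.vandermonde u).det * (Matrix.vandermonde v).det) =
      (∏ i, ∏ j, aWeight x y (u i) (v j) * bWeight (u i) (v j)) * (ikMatrix x y u v).det := by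
  induction n with
  | zero => simp [dwPartition, Subsingleton.elim (fun _ : Fin 0 => false) fun _ => true]
  | succ n ih =>
    obtain ⟨t, u, rfl⟩ : ∃ s r, u = Fin.cons s r := ⟨_, _, (Fin.cons_self_tail u).symm⟩
    have hu' : Function.Injective u := (Fin.cons_injective_iff.1 hu).2
    have ha' : ∀ i j, aWeight x y (u i) (v j) ≠ 0 := fun i j => ha i.succ j
    have hb' : ∀ i j, bWeight (u i) (v j) ≠ 0 := fun i j => hb i.succ j
    have key : ikDefect x y u v t = 0 := by
      -- The 2n + 1 zeros in `t` are the n values `u i` and the n + 1 values `(v j)⁻¹`; they are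
      -- distinct because no `bWeight (u i) (v j)` vanishes.
      refine eq_zero_of_mem_polyFun (ikDefect_mem_polyFun x y u v)
        (Sum.elim u fun j => (v j)⁻¹) ?_ (by simp; omega) ?_ t
      · refine hu'.sumElim (inv_injective.comp hv) fun i j hij => hb' i j ?_
        rw [bWeight, hij, inv_mul_cancel₀ (hv0 j), sub_self]
      · rintro (i | j)
        · exact ikDefect_apply_self x y u v i fun j => mul_ne_zero (ha' i j) (hb' i j)
        -- By antisymmetry, `v j` may be moved to the first row, where the recursion applies.
        · have hs := ikDefect_comp_perm x y u v (v j)⁻¹ (Equiv.swap 0 j) h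
          rw [ikDefect_eq_zero_of_mul_eq_one] at hs
          · exact (mul_eq_zero.1 hs.symm).resolve_left (by
              rcases Int.units_eq_one_or (Equiv.Perm.sign (Equiv.swap 0 j)) with h | h <;> simp [h])
          · simp [hv0]
          · have hinj : Function.Injective fun k : Fin n => Equiv.swap 0 j k.succ :=
              (Equiv.injective _).comp (Fin.succ_injective _)
            exact ih u _ hu' (hv.comp hinj) (fun _ => hv0 _) (fun _ _ => ha' _ _)
              (fun _ _ => hb' _ _) fun i k hik => h _ _ (hinj.ne hik)
    have hdet : (ikPolyMatrix x y u v t).det = (∏ k, aWeight x y t (v k) * bWeight t (v k)) *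
        (ikMatrix x y (Fin.cons t u : Fin (n + 1) → L) v).det := by
      have : ikPolyMatrix x y u v t = (ikMatrix x y (Fin.cons t u : Fin (n + 1) → L) v).updateRow 0
          ((∏ k, aWeight x y t (v k) * bWeight t (v k)) •
            (ikMatrix x y (Fin.cons t u : Fin (n + 1) → L) v).row 0) := by
        ext k j
        cases k using Fin.cases with
        | zero =>
          rw [Matrix.updateRow_self, Pi.smul_apply, smul_eq_mul, ikPolyMatrix_zero,
            ← Finset.prod_erase_mul _ _ (Finset.mem_univ j), mul_assoc]
          exact (mul_inv_cancel_right₀ (mul_ne_zero (ha 0 j) (hb 0 j)) _).symm.trans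
            (mul_assoc _ _ _)
        | succ k => rw [Matrix.updateRow_ne (Fin.succ_ne_zero k)]; rfl
      rw [this, Matrix.det_updateRow_smul]
      congr 1
      exact congrArg _ (Matrix.updateRow_eq_self _ _)
    rw [ikDefect, hdet, sub_eq_zero] at key
    have hprod : ∏ i, ∏ j, aWeight x y ((Fin.cons t u : Fin (n + 1) → L) i) (v j) *
        bWeight ((Fin.cons t u : Fin (n + 1) → L) i) (v j) =
        (∏ j, aWeight x y t (v j) * bWeight t (v j)) *
          ∏ i, ∏ j, aWeight x y (u i) (v j) * bWeight (u i) (v j) := Fin.prod_univ_succ _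
    rw [key, hprod]
    ring

end IzerginKorepin

/-! ### Dividing by Vandermonde determinants through coefficient extraction -/

section CoefficientExtraction

open MvPowerSeries

variable {K : Type*} [CommRing K] {n : ℕ}

/-- The two variables `u i` and `v j` among all variables. -/
def pairEmb (i j : Fin n) : Fin 2 ↪ Fin n ⊕ Fin n where
  toFun := ![Sum.inl i, Sum.inr j]
  inj' := by
    intro a b
    fin_cases a <;> fin_cases b <;> simp

/-- The exponent with value `i` at `u i`, with value `j` at `v j` for `j ≠ last`, and with value
`last + l` at the last `v`. -/
noncomputable def targetExponent (m l : ℕ) : Fin (m + 1) ⊕ Fin (m + 1) →₀ ℕ :=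
  Finsupp.equivFunOnFinite.symm
      (Sum.elim (fun i : Fin (m + 1) => (i : ℕ)) fun j : Fin (m + 1) => (j : ℕ)) +
    Finsupp.single (Sum.inr (Fin.last m)) l

/-- The values `σ i` and the indices `i` have the same sum, so termwise inequality is equality. -/
theorem eq_one_of_forall_apply_le (σ : Equiv.Perm (Fin n)) (h : ∀ i, σ i ≤ i) : σ = 1 := by
  have hs : ∑ i, ((σ i : Fin n) : ℕ) = ∑ i : Fin n, (i : ℕ) :=
    Equiv.sum_comp σ fun i : Fin n => (i : ℕ)
  have := (Finset.sum_eq_sum_iff_of_le fun i _ => Fin.le_def.1 (h i)).1 hs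
  ext i
  exact this i (Finset.mem_univ i)

theorem prod_X_pow_perm (σ τ : Equiv.Perm (Fin n)) :
    (∏ i, (X (Sum.inl i) : MvPowerSeries (Fin n ⊕ Fin n) K) ^ (σ i : ℕ)) *
      ∏ j, (X (Sum.inr j) : MvPowerSeries (Fin n ⊕ Fin n) K) ^ (τ j : ℕ) =
    monomial (Finsupp.equivFunOnFinite.symm
      (Sum.elim (fun i => ((σ i : Fin n) : ℕ)) fun j => ((τ j : Fin n) : ℕ))) 1 := by
  have : ∀ (f : Fin n ⊕ Fin n → ℕ), ∏ s, (X s : MvPowerSeries (Fin n ⊕ Fin n) K) ^ f s =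
      monomial (Finsupp.equivFunOnFinite.symm f) 1 := by
    intro f
    simp only [X_pow_eq]
    rw [MvPowerSeries.prod_monomial, Finset.prod_const_one]
    refine congrArg (fun e => monomial e (1 : K)) (Finsupp.ext fun s => ?_)
    rcases s with s | s <;> simp [Finsupp.single_apply]
  rw [← this, Fintype.prod_sum_type]
  rfl

/-- A monomial ∏ u_i^σ(i) v_j^τ(j) of the Vandermonde product divides the target only if σ(i) ≤ i
and τ(j) ≤ j for all i, j, that is σ = τ = 1. The extra power `l` sits at the last v because there
τ(j) ≤ j holds anyway. -/
theorem coeff_targetExponent_vandermonde (m l : ℕ)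
    (G : MvPowerSeries (Fin (m + 1) ⊕ Fin (m + 1)) K) :
    coeff (targetExponent m l)
      ((Matrix.vandermonde fun i => (X (Sum.inl i) :
          MvPowerSeries (Fin (m + 1) ⊕ Fin (m + 1)) K)).det *
        (Matrix.vandermonde fun j => (X (Sum.inr j) :
          MvPowerSeries (Fin (m + 1) ⊕ Fin (m + 1)) K)).det * G) =
      coeff (Finsupp.single (Sum.inr (Fin.last m)) l) G := by
  rw [← Matrix.det_transpose (Matrix.vandermonde _),
    ← Matrix.det_transpose (Matrix.vandermonde fun j => X (Sum.inr j)), Matrix.det_apply',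
    Matrix.det_apply', Finset.sum_mul_sum, Finset.sum_mul, map_sum]
  have key : ∀ σ τ : Equiv.Perm (Fin (m + 1)), coeff (targetExponent m l)
      ((((Equiv.Perm.sign σ : ℤ) : MvPowerSeries (Fin (m + 1) ⊕ Fin (m + 1)) K) *
        ∏ i, (X (Sum.inl i) : MvPowerSeries (Fin (m + 1) ⊕ Fin (m + 1)) K) ^ (σ i : ℕ)) *
      (((Equiv.Perm.sign τ : ℤ) : MvPowerSeries (Fin (m + 1) ⊕ Fin (m + 1)) K) *
        ∏ j, (X (Sum.inr j) : MvPowerSeries (Fin (m + 1) ⊕ Fin (m + 1)) K) ^ (τ j : ℕ)) * G) =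
      if σ = 1 ∧ τ = 1 then coeff (Finsupp.single (Sum.inr (Fin.last m)) l) G else 0 := by
    intro σ τ
    rw [mul_mul_mul_comm, prod_X_pow_perm, mul_assoc, ← Int.cast_mul, ← zsmul_eq_mul, map_zsmul,
      coeff_monomial_mul, one_mul]
    by_cases h : σ = 1 ∧ τ = 1
    · obtain ⟨rfl, rfl⟩ := h
      rw [if_pos (show (1 : Equiv.Perm (Fin (m + 1))) = 1 ∧ (1 : Equiv.Perm (Fin (m + 1))) = 1
        from ⟨rfl, rfl⟩), targetExponent]
      have hle : ∀ a b : Fin (m + 1) ⊕ Fin (m + 1) →₀ ℕ, ∀ c : K,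
          (if a ≤ a + b then c else 0) = c := fun a b c => if_pos le_self_add
      refine (congrArg _ (hle _ _ _)).trans ?_
      simp only [Equiv.Perm.one_apply]
      rw [add_tsub_cancel_left]
      simp
    · rw [if_neg h, if_neg, smul_zero]
      intro hle
      refine h ⟨eq_one_of_forall_apply_le σ fun i => ?_, eq_one_of_forall_apply_le τ fun j => ?_⟩
      · have := hle (Sum.inl i)
        simpa [targetExponent] using this
      · rcases eq_or_ne j (Fin.last m) with rfl | hj
        · exact Fin.le_last _
        · have := hle (Sum.inr j)
          simpa [targetExponent, hj.symm] using this
  simp only [Matrix.transpose_apply, Matrix.vandermonde_apply, Finset.sum_mul, map_sum, key,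
    ite_and]
  simp

theorem mapDomain_pairEmb (i j : Fin n) (w : Fin 2 →₀ ℕ) :
    Finsupp.mapDomain (pairEmb i j) w =
      Finsupp.single (Sum.inl i) (w 0) + Finsupp.single (Sum.inr j) (w 1) := by
  have : w = Finsupp.single 0 (w 0) + Finsupp.single 1 (w 1) := by
    ext a; fin_cases a <;> simp
  conv_lhs => rw [this]
  rw [Finsupp.mapDomain_add, Finsupp.mapDomain_single, Finsupp.mapDomain_single]
  rfl

theorem coeff_targetExponent_prod_rename (m l : ℕ) (g : MvPowerSeries (Fin 2) K)
    (σ : Equiv.Perm (Fin (m + 1))) :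
    coeff (targetExponent m l) (∏ i : Fin (m + 1), rename (pairEmb i (σ i)) g) =
      ∏ i : Fin (m + 1), coeff (Finsupp.single 0 (i : ℕ) + Finsupp.single 1
        ((σ i : ℕ) + if σ i = Fin.last m then l else 0)) g := by
  classical
  set c : Fin (m + 1) → Fin 2 →₀ ℕ := fun i => Finsupp.single 0 (i : ℕ) + Finsupp.single 1
        ((σ i : ℕ) + if σ i = Fin.last m then l else 0) with hc
  set L : Fin (m + 1) →₀ (Fin (m + 1) ⊕ Fin (m + 1) →₀ ℕ) := Finsupp.equivFunOnFinite.symm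
    fun i => Finsupp.embDomain (pairEmb i (σ i)) (c i) with hL
  have hLi : ∀ i, L i = Finsupp.single (Sum.inl i) (i : ℕ) + Finsupp.single (Sum.inr (σ i))
      ((σ i : ℕ) + if σ i = Fin.last m then l else 0) := by
    intro i
    rw [hL, Finsupp.coe_equivFunOnFinite_symm, Finsupp.embDomain_eq_mapDomain, mapDomain_pairEmb]
    simp [hc]
  have hinl : ∀ k : Fin (m + 1), targetExponent m l (Sum.inl k) = k := by
    intro k; simp [targetExponent]
  have hinr : ∀ k : Fin (m + 1), targetExponent m l (Sum.inr k) =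
      (k : ℕ) + if k = Fin.last m then l else 0 := by
    intro k; simp [targetExponent, Finsupp.single_apply, eq_comm]
  -- The factor with index i involves only u_i and v_σ(i), and no other factor involves these. Hence
  -- only one splitting of the target exponent contributes.
  rw [coeff_prod, Finset.sum_eq_single L]
  · refine Finset.prod_congr rfl fun i _ => ?_
    rw [hL, Finsupp.coe_equivFunOnFinite_symm, coeff_embDomain_rename]
  · intro L' hL' hne
    by_contra h0
    have hr : ∀ i, ∃ a b, L' i = Finsupp.single (Sum.inl i) a +
        Finsupp.single (Sum.inr (σ i)) b := by
      intro i
      by_contra hcon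
      refine h0 (Finset.prod_eq_zero (Finset.mem_univ i) (coeff_rename_eq_zero _ _ ?_))
      rintro ⟨w, hw⟩
      exact hcon ⟨w 0, w 1, by rw [← hw, mapDomain_pairEmb]⟩
    choose a b hab using hr
    rw [Finset.mem_finsuppAntidiag] at hL'
    have hsum := hL'.1
    refine hne (Finsupp.ext fun i => ?_)
    rw [hLi, hab]
    have h1 := DFunLike.congr_fun hsum (Sum.inl i)
    have h2 := DFunLike.congr_fun hsum (Sum.inr (σ i))
    rw [hinl, Finsupp.finsetSum_apply] at h1
    rw [hinr, Finsupp.finsetSum_apply] at h2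
    simp only [hab] at h1 h2
    simp [Finsupp.single_apply] at h1 h2
    rw [h1, h2]
  · intro h
    refine absurd ?_ h
    rw [Finset.mem_finsuppAntidiag]
    refine ⟨?_, Finset.subset_univ _⟩
    ext (k | k)
    · rw [hinl, Finsupp.finsetSum_apply]
      simp [hLi, Finsupp.single_apply]
    · rw [hinr, Finsupp.finsetSum_apply, ← Equiv.sum_comp σ.symm]
      simp only [hLi]
      simp [Finsupp.single_apply, Finset.sum_add_distrib]

theorem coeff_targetExponent_det (m l : ℕ) (g : MvPowerSeries (Fin 2) K) :
    coeff (targetExponent m l)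
      (Matrix.of fun i j : Fin (m + 1) => rename (pairEmb i j) g).det =
    (Matrix.of fun i j : Fin (m + 1) => coeff (Finsupp.single 0 (i : ℕ) + Finsupp.single 1
        ((j : ℕ) + if j = Fin.last m then l else 0)) g).det := by
  rw [← Matrix.det_transpose, Matrix.det_apply, ← Matrix.det_transpose, Matrix.det_apply, map_sum]
  refine Finset.sum_congr rfl fun σ _ => ?_
  rw [Units.smul_def, Units.smul_def, map_zsmul]
  congr 1
  exact coeff_targetExponent_prod_rename m l g σ

end CoefficientExtraction

/-! ### Compatibility with ring homomorphisms -/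

section Map

variable {R S : Type*} [CommRing R] [CommRing S] (φ : R →+* S) {n : ℕ}

theorem map_bWeight (u v : R) : φ (bWeight u v) = bWeight (φ u) (φ v) := by
  simp [bWeight]

theorem map_aWeight (x y u v : R) :
    φ (aWeight x y u v) = aWeight (φ x) (φ y) (φ u) (φ v) := by
  simp [aWeight]

theorem map_vertexWeight (x y u v : R) (s s' h h' : Bool) :
    φ (vertexWeight x y u v s s' h h') = vertexWeight (φ x) (φ y) (φ u) (φ v) s s' h h' := by
  cases s <;> cases s' <;> cases h <;> cases h' <;>
    simp [vertexWeight, map_aWeight, map_bWeight]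

theorem mapMatrix_rowMatrix (x y : R) (u : Fin n → R) (v : R) (t t' : Fin n → Bool) :
    φ.mapMatrix (rowMatrix x y u v t t') = rowMatrix (φ x) (φ y) (φ ∘ u) (φ v) t t' := by
  rw [rowMatrix, map_list_prod, List.map_ofFn, rowMatrix]
  congr 2
  funext j
  ext h h'
  exact map_vertexWeight φ _ _ _ _ _ _ _ _

theorem mapMatrix_rowTransfer (x y : R) (u : Fin n → R) (v : R) :
    φ.mapMatrix (rowTransfer x y u v) = rowTransfer (φ x) (φ y) (φ ∘ u) (φ v) := by
  ext t t'
  exact congrFun (congrFun (mapMatrix_rowMatrix φ x y u v t t') _) _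

theorem map_dwPartition (x y : R) (u : Fin n → R) (vs : List R) :
    φ (dwPartition x y u vs) = dwPartition (φ x) (φ y) (φ ∘ u) (vs.map φ) := by
  have h : φ.mapMatrix (vs.map (rowTransfer x y u)).prod =
      ((vs.map φ).map (rowTransfer (φ x) (φ y) (φ ∘ u))).prod := by
    rw [map_list_prod, List.map_map, List.map_map]
    congr 2
    funext v
    exact mapMatrix_rowTransfer φ x y u v
  exact congrFun (congrFun h _) _

end Map

/-! ### From the Izergin–Korepin formula to determinants of coefficients -/

section HomogeneousLimit

open MvPowerSeries

variable {K : Type*} [Field K] {n : ℕ}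

/-- The double generating function of the matrix for the unrefined enumeration. -/
noncomputable def baseGenFun (x y ν : K) : MvPowerSeries (Fin 2) K :=
  C (1 - ν) * (1 - X 0 * X 1)⁻¹ + C ν * (1 - C x * X 0 - X 1 - C (y - x) * X 0 * X 1)⁻¹

/-- The numerator (1-ν)a + νb factors as stated exactly when the coefficients of uv agree, and this
is the equation relating x, y and ν. -/
theorem baseGenFun_mul {x y ν : K} (h : x * ν * (1 - ν) = ν + y * (1 - ν)) :
    baseGenFun x y ν * (aWeight (C x) (C y) (X 0) (X 1) * bWeight (X 0) (X 1)) =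
      (1 - C ((1 - ν) * x) * X 0) * (1 - C (1 - ν) * X 1) := by
  have ha : aWeight (C x) (C y) (X 0) (X 1) =
      (1 - C x * X 0 - X 1 - C (y - x) * X 0 * X 1 : MvPowerSeries (Fin 2) K) := by
    simp [aWeight]
  have h1 := MvPowerSeries.inv_mul_cancel (1 - X 0 * X 1 : MvPowerSeries (Fin 2) K) (by simp)
  have h2 := MvPowerSeries.inv_mul_cancel
    (1 - C x * X 0 - X 1 - C (y - x) * X 0 * X 1 : MvPowerSeries (Fin 2) K) (by simp)
  have hC := congrArg (C (σ := Fin 2)) h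
  simp only [map_mul, map_add, map_sub, map_one] at hC
  rw [baseGenFun, ha, bWeight]
  simp only [map_mul, map_sub, map_one] at h1 h2 ⊢
  linear_combination (1 - C ν) * (1 - C x * X 0 - X 1 - (C y - C x) * X 0 * X 1) * h1 +
    C ν * (1 - X 0 * X 1) * h2 + X 0 * X 1 * hC

theorem rename_baseGenFun_mul {x y ν : K} (h : x * ν * (1 - ν) = ν + y * (1 - ν)) (i j : Fin n) :
    rename (pairEmb i j) (baseGenFun x y ν) *
        (aWeight (C x) (C y) (X (Sum.inl i)) (X (Sum.inr j)) *
          bWeight (X (Sum.inl i)) (X (Sum.inr j))) =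
      (1 - C ((1 - ν) * x) * X (Sum.inl i)) * (1 - C (1 - ν) * X (Sum.inr j)) := by
  have := congrArg (rename (pairEmb i j)) (baseGenFun_mul h)
  have h0 : pairEmb i j 0 = Sum.inl i := rfl
  have h1 : pairEmb i j 1 = Sum.inr j := rfl
  simpa [aWeight, bWeight, h0, h1] using this

/-- The Izergin–Korepin formula is applied to indeterminates in the fraction field of the power
series ring. The numerators from `baseGenFun_mul` leave the determinant as row and column factors.
-/
theorem det_rename_baseGenFun {x y ν : K} (hx : x ≠ 0)
    (h : x * ν * (1 - ν) = ν + y * (1 - ν)) :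
    (∏ i : Fin n, ∏ j : Fin n, aWeight (C x) (C y) (X (Sum.inl i)) (X (Sum.inr j)) *
          bWeight (X (Sum.inl i)) (X (Sum.inr j))) *
        (Matrix.of fun i j : Fin n => rename (pairEmb i j) (baseGenFun x y ν)).det =
      dwPartition (C x) (C y) (fun i : Fin n => X (Sum.inl i))
          (List.ofFn fun j : Fin n => (X (Sum.inr j) : MvPowerSeries (Fin n ⊕ Fin n) K)) *
        ((Matrix.vandermonde fun i : Fin n => X (Sum.inl i)).det *
          (Matrix.vandermonde fun j : Fin n => X (Sum.inr j)).det) *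
        ((∏ i : Fin n, (1 - C ((1 - ν) * x) * X (Sum.inl i))) *
          ∏ j : Fin n, (1 - C (1 - ν) * X (Sum.inr j))) := by
  set R := MvPowerSeries (Fin n ⊕ Fin n) K with hR
  set φ : R →+* FractionRing R := algebraMap R (FractionRing R) with hφ
  have hinj : Function.Injective φ := IsFractionRing.injective R (FractionRing R)
  have hne : ∀ f : R, constantCoeff f ≠ 0 → φ f ≠ 0 := by
    intro f hf h0
    rw [map_eq_zero_iff φ hinj] at h0
    exact hf (by rw [h0, map_zero])
  have hXinj : Function.Injective (X : Fin n ⊕ Fin n → R) := fun _ _ h => X_inj.1 h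
  have ha : ∀ i j, φ (aWeight (C x) (C y) (X (Sum.inl i)) (X (Sum.inr j))) ≠ 0 := fun i j =>
    hne _ (by simp [aWeight])
  have hb : ∀ i j, φ (bWeight (X (Sum.inl i)) (X (Sum.inr j))) ≠ 0 := fun i j =>
    hne _ (by simp [bWeight])
  have ik := dwPartition_mul_det_vandermonde (φ (C x)) (φ (C y)) (fun i => φ (X (Sum.inl i)))
    (fun j => φ (X (Sum.inr j))) (hinj.comp (hXinj.comp Sum.inl_injective))
    (hinj.comp (hXinj.comp Sum.inr_injective))
    (fun j h0 => by
      rw [map_eq_zero_iff φ hinj] at h0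
      simpa using congrArg (coeff (Finsupp.single (Sum.inr j) 1)) h0)
    (fun i j => by rw [← map_aWeight]; exact ha i j)
    (fun i j => by rw [← map_bWeight]; exact hb i j)
    -- The constant term of the crossing scalar is x, which is nonzero.
    (fun i j _ => by
      simp only [← map_mul, ← map_sub, ← map_add]
      exact hne _ (by simpa using hx))
  apply hinj
  have hdet : φ (Matrix.of fun i j : Fin n => rename (pairEmb i j) (baseGenFun x y ν)).det =
      (∏ i : Fin n, φ (1 - C ((1 - ν) * x) * X (Sum.inl i))) *
      ((∏ j : Fin n, φ (1 - C (1 - ν) * X (Sum.inr j))) *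
      (ikMatrix (φ (C x)) (φ (C y)) (fun i => φ (X (Sum.inl i)))
        (fun j => φ (X (Sum.inr j)))).det) := by
    rw [RingHom.map_det, ← Matrix.det_mul_row, ← Matrix.det_mul_column]
    congr 1
    ext i j
    simp only [RingHom.mapMatrix_apply, Matrix.map_apply, Matrix.of_apply, ikMatrix,
      ← map_aWeight, ← map_bWeight]
    rw [← mul_assoc, eq_mul_inv_iff_mul_eq₀ (mul_ne_zero (ha i j) (hb i j)), ← map_mul, ← map_mul,
      ← map_mul, rename_baseGenFun_mul h]
  rw [map_mul, hdet]
  simp only [map_mul, map_prod, map_dwPartition, List.map_ofFn, map_aWeight, map_bWeight,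
    RingHom.map_det]
  have hvu : φ.mapMatrix (Matrix.vandermonde fun i : Fin n => X (Sum.inl i)) =
    Matrix.vandermonde fun i : Fin n => φ (X (Sum.inl i)) := by ext; simp [Matrix.vandermonde_apply]
  have hvv : φ.mapMatrix (Matrix.vandermonde fun i : Fin n => X (Sum.inr i)) =
    Matrix.vandermonde fun i : Fin n => φ (X (Sum.inr i)) := by ext; simp [Matrix.vandermonde_apply]
  rw [hvu, hvv]
  simp only [Function.comp_def] at ik ⊢
  simp only [← map_mul] at ik ⊢
  linear_combination (-(∏ i : Fin n, φ (1 - C ((1 - ν) * x) * X (Sum.inl i))) *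
    (∏ j : Fin n, φ (1 - C (1 - ν) * X (Sum.inr j)))) * ik

/-- The embedding that selects the last `v`. -/
def lastEmb (m : ℕ) : Unit ↪ Fin (m + 1) ⊕ Fin (m + 1) where
  toFun _ := Sum.inr (Fin.last m)
  inj' _ _ _ := rfl

/-- The quotient of det f(u_i, v_j) by the Vandermonde determinants is specialised to u = 0 and v =
0 except for the last v. There every b is 1, and each of the m + 1 weights a in the last row of the
model is 1 - V. -/
theorem exists_powerSeries_coeff_eq_det {x y ν : K} (hx : x ≠ 0)
    (h : x * ν * (1 - ν) = ν + y * (1 - ν)) (m : ℕ) :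
    ∃ G : PowerSeries K,
      (1 - PowerSeries.X) ^ (m + 1) * G = (1 - PowerSeries.C (1 - ν) * PowerSeries.X) *
        dwPartition (PowerSeries.C x) (PowerSeries.C y) (fun _ : Fin (m + 1) => 0)
          (List.ofFn fun j : Fin (m + 1) => if j = Fin.last m then PowerSeries.X else 0) ∧
      ∀ l, PowerSeries.coeff l G = (Matrix.of fun i j : Fin (m + 1) =>
        matrixOfGenFun (baseGenFun x y ν) i ((j : ℕ) + if j = Fin.last m then l else 0)).det := by
  set P : MvPowerSeries (Fin (m + 1) ⊕ Fin (m + 1)) K :=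
    ∏ i : Fin (m + 1), ∏ j : Fin (m + 1), aWeight (C x) (C y) (X (Sum.inl i)) (X (Sum.inr j)) *
          bWeight (X (Sum.inl i)) (X (Sum.inr j)) with hP
  have hP0 : P * P⁻¹ = 1 := MvPowerSeries.mul_inv_cancel _ (by
    simp [hP, aWeight, bWeight])
  set Q : MvPowerSeries (Fin (m + 1) ⊕ Fin (m + 1)) K :=
    dwPartition (C x) (C y) (fun i : Fin (m + 1) => X (Sum.inl i))
          (List.ofFn fun j : Fin (m + 1) => X (Sum.inr j)) *
        ((∏ i : Fin (m + 1), (1 - C ((1 - ν) * x) * X (Sum.inl i))) *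
          ∏ j : Fin (m + 1), (1 - C (1 - ν) * X (Sum.inr j))) with hQ
  have hmain := det_rename_baseGenFun (n := m + 1) hx h
  set ψ := (killCompl (R := K) (lastEmb m)) with hψ
  have hψu : ∀ i, ψ (X (Sum.inl i)) = 0 := fun i => killCompl_X_eq_zero (by
    rintro ⟨_, h'⟩; exact Sum.inr_ne_inl h')
  have hψv : ∀ j, ψ (X (Sum.inr j)) =
      if j = Fin.last m then (PowerSeries.X : PowerSeries K) else 0 := by
    intro j
    split_ifs with hj
    · subst hj; exact killCompl_X (e := lastEmb m) ()
    · exact killCompl_X_eq_zero (by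
        rintro ⟨_, h'⟩; exact hj (Sum.inr_injective h').symm)
  have hψC : ∀ c, ψ (C c) = PowerSeries.C c := fun c => killCompl_C c
  refine ⟨ψ (P⁻¹ * Q), ?_, fun l => ?_⟩
  · have hψP : ψ P = (1 - PowerSeries.X) ^ (m + 1) := by
      have : ∀ i j : Fin (m + 1), ψ (aWeight (C x) (C y) (X (Sum.inl i)) (X (Sum.inr j)) *
          bWeight (X (Sum.inl i)) (X (Sum.inr j))) =
          if j = Fin.last m then (1 - PowerSeries.X : PowerSeries K) else 1 := by
        intro i j
        simp only [aWeight, bWeight, map_mul, map_sub, map_one, hψu, hψv]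
        split_ifs <;> simp
      rw [hP, map_prod]
      simp only [map_prod, this]
      simp
    have hψQ : ψ Q = (1 - PowerSeries.C (1 - ν) * PowerSeries.X) *
        dwPartition (PowerSeries.C x) (PowerSeries.C y) (fun _ : Fin (m + 1) => 0)
          (List.ofFn fun j : Fin (m + 1) => if j = Fin.last m then PowerSeries.X else 0) := by
      have h1 := map_dwPartition ψ.toRingHom (C x) (C y) (fun i : Fin (m + 1) => X (Sum.inl i))
          (List.ofFn fun j : Fin (m + 1) => X (Sum.inr j))
      simp only [AlgHom.toRingHom_eq_coe, List.map_ofFn, Function.comp_def, RingHom.coe_coe,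
        hψu, hψv, hψC] at h1
      rw [hQ, map_mul, h1, mul_comm]
      congr 1
      have : ∀ j : Fin (m + 1), ψ (1 - C (1 - ν) * X (Sum.inr j)) =
          if j = Fin.last m then 1 - PowerSeries.C (1 - ν) * PowerSeries.X else 1 := by
        intro j
        rw [map_sub, map_mul, hψv, hψC, map_one]
        split_ifs <;> simp
      rw [map_mul, map_prod, map_prod]
      simp only [this]
      simp only [map_mul, map_sub, map_one, hψu]
      simp
    rw [← hψP, ← map_mul, ← mul_assoc, hP0, one_mul, hψQ]
  · have h1 : (Matrix.of fun i j : Fin (m + 1) => rename (pairEmb i j) (baseGenFun x y ν)).det =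
        (Matrix.vandermonde fun i => X (Sum.inl i)).det *
          (Matrix.vandermonde fun j => X (Sum.inr j)).det * (P⁻¹ * Q) := by
      rw [hQ]
      linear_combination P⁻¹ * hmain -
        (Matrix.of fun i j : Fin (m + 1) => rename (pairEmb i j) (baseGenFun x y ν)).det * hP0
    have h2 := coeff_targetExponent_det m l (baseGenFun x y ν)
    rw [h1, coeff_targetExponent_vandermonde] at h2
    refine Eq.trans ?_ h2
    rw [PowerSeries.coeff, coeff_killCompl, Finsupp.embDomain_single]
    rfl

end HomogeneousLimit

/-! ### Matrix products as path sums; 0-1 paths and partial sums -/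

section Paths

theorem list_prod_ofFn_apply {R ι : Type*} [CommRing R] [Fintype ι] [DecidableEq ι] {n : ℕ}
    (A : Fin n → Matrix ι ι R) (a b : ι) :
    (List.ofFn A).prod a b =
      ∑ p : Fin (n + 1) → ι, if p 0 = a ∧ p (Fin.last n) = b then
        ∏ i, A i (p i.castSucc) (p i.succ) else 0 := by
  induction n generalizing a with
  | zero =>
    rw [← (Equiv.funUnique (Fin 1) ι).symm.sum_comp]
    simp [Matrix.one_apply, Equiv.funUnique, ite_and]
  | succ n ih =>
    rw [List.ofFn_succ, List.prod_cons, Matrix.mul_apply, sum_fin_succ_arrow]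
    trans ∑ p : Fin (n + 1) → ι, if p (Fin.last n) = b then
      A 0 a (p 0) * ∏ i, A (Fin.succ i) (p i.castSucc) (p i.succ) else 0
    · simp only [ih, Finset.mul_sum]
      rw [Finset.sum_comm]
      refine Finset.sum_congr rfl fun p _ => ?_
      rw [Finset.sum_eq_single (p 0)]
      · simp
      · intro c _ hc; simp [hc.symm]
      · simp
    · rw [Finset.sum_eq_single a]
      · simp [Fin.prod_univ_succ, ← Fin.succ_last]
      · intro c _ hc; simp [hc]
      · simp

/-- A path of states `0`, `1` as integers. -/
def stateValue (b : Bool) : ℤ := if b then 1 else 0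

/-- The increments of a path. -/
def pathDiff {n : ℕ} (p : Fin (n + 1) → Bool) (k : Fin n) : ℤ :=
  stateValue (p k.succ) - stateValue (p k.castSucc)

/-- The path of partial sums of a sequence whose partial sums are `0` or `1`. -/
def sumPath {n : ℕ} (f : Fin n → ℤ) (i : Fin (n + 1)) : Bool :=
  decide (∑ l with Fin.castSucc l < i, f l = 1)

variable {n : ℕ}

theorem sum_lt_pathDiff (p : Fin (n + 1) → Bool) (i : Fin (n + 1)) :
    ∑ l with Fin.castSucc l < i, pathDiff p l = stateValue (p i) - stateValue (p 0) := by
  induction i using Fin.induction with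
  | zero => simp
  | succ k ih =>
    have : (Finset.univ.filter fun l : Fin n => l.castSucc < k.succ) =
        insert k (Finset.univ.filter fun l : Fin n => l.castSucc < k.castSucc) := by
      ext l
      simp only [Finset.mem_filter, Finset.mem_univ, true_and, Finset.mem_insert,
        Fin.lt_def, Fin.ext_iff, Fin.val_castSucc, Fin.val_succ]
      omega
    rw [this, Finset.sum_insert (by simp), ih, pathDiff]
    ring

theorem filter_castSucc_lt_succ (k : Fin n) :
    (Finset.univ.filter fun l : Fin n => l.castSucc < k.succ) = Finset.Iic k := by
  ext l
  simp only [Finset.mem_filter, Finset.mem_univ, true_and, Finset.mem_Iic, Fin.lt_def, Fin.le_def,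
    Fin.val_castSucc, Fin.val_succ]
  omega

theorem sum_Iic_pathDiff {p : Fin (n + 1) → Bool} (h0 : p 0 = false) (k : Fin n) :
    ∑ l ∈ Finset.Iic k, pathDiff p l = stateValue (p k.succ) := by
  rw [← filter_castSucc_lt_succ, sum_lt_pathDiff, h0]
  simp [stateValue]

theorem sum_pathDiff {p : Fin (n + 1) → Bool} (h0 : p 0 = false) (h1 : p (Fin.last n) = true) :
    ∑ l, pathDiff p l = 1 := by
  have := sum_lt_pathDiff p (Fin.last n)
  rw [h0, h1, Finset.filter_true_of_mem fun l _ => Fin.castSucc_lt_last l] at this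
  simpa [stateValue] using this

theorem sum_Ioi_pathDiff {p : Fin (n + 1) → Bool} (h0 : p 0 = false) (h1 : p (Fin.last n) = true)
    (k : Fin n) : ∑ l ∈ Finset.Ioi k, pathDiff p l = 1 - stateValue (p k.succ) := by
  have h : Finset.Ioi k = (Finset.Iic k)ᶜ := by ext l; simp
  have := Finset.sum_add_sum_compl (Finset.Iic k) (pathDiff p)
  rw [sum_Iic_pathDiff h0, sum_pathDiff h0 h1] at this
  rw [h]
  linarith

theorem sumPath_pathDiff {p : Fin (n + 1) → Bool} (h0 : p 0 = false) :
    sumPath (pathDiff p) = p := by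
  ext i
  rw [sumPath, sum_lt_pathDiff, h0]
  cases p i <;> simp [stateValue]

theorem sumPath_zero (f : Fin n → ℤ) : sumPath f 0 = false := by
  simp [sumPath]

theorem sumPath_last {f : Fin n → ℤ} (h : ∑ l, f l = 1) : sumPath f (Fin.last n) = true := by
  rw [sumPath, Finset.filter_true_of_mem fun l _ => Fin.castSucc_lt_last l]
  simpa using h

theorem stateValue_sumPath {f : Fin n → ℤ}
    (h : ∀ k, ∑ l ∈ Finset.Iic k, f l = 0 ∨ ∑ l ∈ Finset.Iic k, f l = 1) (i : Fin (n + 1)) :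
    stateValue (sumPath f i) = ∑ l with Fin.castSucc l < i, f l := by
  have : ∑ l with Fin.castSucc l < i, f l = 0 ∨ ∑ l with Fin.castSucc l < i, f l = 1 := by
    cases i using Fin.cases with
    | zero => simp
    | succ k => rw [filter_castSucc_lt_succ]; exact h k
  rcases this with h | h <;> simp [sumPath, h, stateValue]

theorem pathDiff_sumPath {f : Fin n → ℤ}
    (h : ∀ k, ∑ l ∈ Finset.Iic k, f l = 0 ∨ ∑ l ∈ Finset.Iic k, f l = 1) :
    pathDiff (sumPath f) = f := by
  ext k
  rw [pathDiff, stateValue_sumPath h, stateValue_sumPath h, filter_castSucc_lt_succ,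
    ← Finset.Iio_insert, Finset.sum_insert (by simp)]
  have : (Finset.univ.filter fun l : Fin n => l.castSucc < k.castSucc) = Finset.Iio k := by
    ext l; simp
  rw [this]
  ring

end Paths

/-! ### Six-vertex configurations and alternating sign matrices -/

section Configurations

variable {R : Type*} [CommRing R] {n : ℕ}

/-- The configurations of the six-vertex model with domain wall boundary conditions: for each
column the path of its vertical states, for each row the path of its horizontal states. -/
structure IsConfiguration (c : (Fin n → Fin (n + 1) → Bool) × (Fin n → Fin (n + 1) → Bool)) :
    Prop where
  col_first : ∀ j, c.1 j 0 = false
  col_last : ∀ j, c.1 j (Fin.last n) = true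
  row_first : ∀ i, c.2 i 0 = false
  row_last : ∀ i, c.2 i (Fin.last n) = true

/-- The weight of the vertex in row `i` and column `j` of a configuration. -/
def configWeight (x y : R) (u v : Fin n → R)
    (c : (Fin n → Fin (n + 1) → Bool) × (Fin n → Fin (n + 1) → Bool)) (i j : Fin n) : R :=
  vertexWeight x y (u j) (v i) (c.1 j i.castSucc) (c.1 j i.succ) (c.2 i j.castSucc) (c.2 i j.succ)

open Classical in
theorem dwPartition_eq_sum_config (x y : R) (u v : Fin n → R) :
    dwPartition x y u (List.ofFn v) =
      ∑ c, if IsConfiguration c then ∏ i, ∏ j, configWeight x y u v c i j else 0 := by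
  rw [dwPartition, List.map_ofFn, list_prod_ofFn_apply, Fintype.sum_prod_type,
    ← (Equiv.piComm fun (_ : Fin (n + 1)) (_ : Fin n) => Bool).symm.sum_comp]
  refine Finset.sum_congr rfl fun H _ => ?_
  by_cases hH : (∀ j, H j 0 = false) ∧ ∀ j, H j (Fin.last n) = true
  · rw [if_pos ⟨funext hH.1, funext hH.2⟩]
    simp only [Function.comp_apply, rowTransfer, Matrix.of_apply, rowMatrix, list_prod_ofFn_apply]
    rw [Finset.prod_univ_sum, Fintype.piFinset_univ]
    refine Finset.sum_congr rfl fun S _ => ?_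
    by_cases hS : ∀ i, S i 0 = false ∧ S i (Fin.last n) = true
    · rw [if_pos ⟨hH.1, hH.2, fun i => (hS i).1, fun i => (hS i).2⟩]
      refine Finset.prod_congr rfl fun i _ => ?_
      rw [if_pos (hS i)]
      rfl
    · rw [if_neg fun h => hS fun i => ⟨h.row_first i, h.row_last i⟩]
      push Not at hS
      obtain ⟨i, hi⟩ := hS
      exact Finset.prod_eq_zero (Finset.mem_univ i) (if_neg fun h => hi h.1 h.2)
  · rw [if_neg, Finset.sum_eq_zero]
    · intro S _
      exact if_neg fun h => hH ⟨h.col_first, h.col_last⟩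
    · exact fun h => hH ⟨congrFun h.1, congrFun h.2⟩

/-- The ice rule: at a vertex of nonzero weight, the vertical and horizontal increments agree. Their
common value is the matrix entry. -/
theorem vertexWeight_eq_zero (x y u v : R) {s s' h h' : Bool}
    (hne : stateValue s' - stateValue s ≠ stateValue h' - stateValue h) :
    vertexWeight x y u v s s' h h' = 0 := by
  cases s <;> cases s' <;> cases h <;> cases h' <;> simp_all [stateValue, vertexWeight]

/-- The vertical and horizontal paths of partial sums of a matrix. -/
def matrixConfig (B : Matrix (Fin n) (Fin n) ℤ) :
    (Fin n → Fin (n + 1) → Bool) × (Fin n → Fin (n + 1) → Bool) :=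
  (fun j => sumPath fun i => B i j, fun i => sumPath (B i))

theorem IsASM.isConfiguration {B : Matrix (Fin n) (Fin n) ℤ} (hB : IsASM B) :
    IsConfiguration (matrixConfig B) where
  col_first _ := sumPath_zero _
  col_last j := sumPath_last (hB.col_sum j)
  row_first _ := sumPath_zero _
  row_last i := sumPath_last (hB.row_sum i)

theorem IsASM.pathDiff_col {B : Matrix (Fin n) (Fin n) ℤ} (hB : IsASM B) (i j : Fin n) :
    pathDiff ((matrixConfig B).1 j) i = B i j :=
  congrFun (pathDiff_sumPath (f := fun i => B i j) fun k => hB.col_partial k j) i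

theorem IsASM.pathDiff_row {B : Matrix (Fin n) (Fin n) ℤ} (hB : IsASM B) (i j : Fin n) :
    pathDiff ((matrixConfig B).2 i) j = B i j :=
  congrFun (pathDiff_sumPath (hB.row_partial i)) j

theorem IsConfiguration.exists_isASM
    {c : (Fin n → Fin (n + 1) → Bool) × (Fin n → Fin (n + 1) → Bool)} (hc : IsConfiguration c)
    (h : ∀ i j, pathDiff (c.1 j) i = pathDiff (c.2 i) j) :
    ∃ B, IsASM B ∧ matrixConfig B = c := by
  have hcol : ∀ j, (fun i => pathDiff (c.2 i) j) = pathDiff (c.1 j) := fun j =>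
    funext fun i => (h i j).symm
  have h01 : ∀ b, stateValue b = 0 ∨ stateValue b = 1 := by decide
  refine ⟨Matrix.of fun i j => pathDiff (c.2 i) j, ⟨?_, ?_, ?_, ?_, ?_⟩, ?_⟩
  · intro i j
    simp only [Matrix.of_apply, pathDiff]
    rcases h01 (c.2 i j.succ) with h1 | h1 <;> rcases h01 (c.2 i j.castSucc) with h2 | h2 <;>
      rw [h1, h2] <;> norm_num
  · intro i j
    exact (sum_Iic_pathDiff (hc.row_first i) j).symm ▸ h01 _
  · intro i j
    simp only [Matrix.of_apply, ← h]
    exact (sum_Iic_pathDiff (hc.col_first j) i).symm ▸ h01 _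
  · exact fun i => sum_pathDiff (hc.row_first i) (hc.row_last i)
  · intro j
    simp only [Matrix.of_apply, ← h]
    exact sum_pathDiff (hc.col_first j) (hc.col_last j)
  · refine Prod.ext (funext fun j => ?_) (funext fun i => ?_)
    · change sumPath (fun i => pathDiff (c.2 i) j) = _
      rw [hcol, sumPath_pathDiff (hc.col_first j)]
    · exact sumPath_pathDiff (hc.row_first i)

/-- A configuration violating the ice rule somewhere has weight 0; the others are exactly the
partial sum paths of alternating sign matrices. -/
theorem dwPartition_eq_sum_asm (x y : R) (u v : Fin n → R) :
    dwPartition x y u (List.ofFn v) =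
      ∑ B ∈ asmFinset n, ∏ i, ∏ j, configWeight x y u v (matrixConfig B) i j := by
  classical
  rw [dwPartition_eq_sum_config, ← Finset.sum_filter]
  symm
  refine Finset.sum_of_injOn matrixConfig ?_ ?_ ?_ ?_
  · intro B hB B' hB' he
    ext i j
    rw [← ((mem_asmFinset B).1 hB).pathDiff_row, ← ((mem_asmFinset B').1 hB').pathDiff_row, he]
  · intro B hB
    simpa using ((mem_asmFinset B).1 hB).isConfiguration
  · intro c hc hn
    rw [Finset.mem_filter] at hc
    by_cases h : ∀ i j, pathDiff (c.1 j) i = pathDiff (c.2 i) j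
    · obtain ⟨B, hB, rfl⟩ := hc.2.exists_isASM h
      exact absurd ⟨B, (mem_asmFinset B).2 hB, rfl⟩ hn
    · push Not at h
      obtain ⟨i, j, hij⟩ := h
      exact Finset.prod_eq_zero (Finset.mem_univ i)
        (Finset.prod_eq_zero (Finset.mem_univ j) (vertexWeight_eq_zero _ _ _ _ hij))
  · intro B _; rfl

end Configurations

/-! ### Statistics of alternating sign matrices as vertex counts -/

section Statistics

variable {R : Type*} [CommRing R] {n : ℕ} {B : Matrix (Fin n) (Fin n) ℤ}

/-- The predicate that the four edges at a vertex have state `0`. -/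
def IsEmptyVertex (B : Matrix (Fin n) (Fin n) ℤ) (i j : Fin n) : Prop :=
  (matrixConfig B).1 j i.succ = false ∧ (matrixConfig B).2 i j.succ = false ∧ B i j ≠ -1

instance (i j : Fin n) : Decidable (IsEmptyVertex B i j) := by
  unfold IsEmptyVertex; infer_instance

theorem inversions_eq_sum : inversions B =
    ∑ i, ∑ k, (∑ l ∈ Finset.Ioi k, B i l) * (∑ j ∈ Finset.Ioi i, B j k) := by
  unfold inversions
  refine Finset.sum_congr rfl fun i _ => ?_
  rw [Finset.sum_comm]
  refine Finset.sum_congr rfl fun k _ => ?_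
  rw [Finset.sum_comm, Finset.sum_mul_sum]

theorem IsASM.sum_Ioi_row (hB : IsASM B) (i k : Fin n) :
    ∑ l ∈ Finset.Ioi k, B i l = 1 - stateValue ((matrixConfig B).2 i k.succ) := by
  have hc := hB.isConfiguration
  rw [← sum_Ioi_pathDiff (hc.row_first i) (hc.row_last i)]
  exact Finset.sum_congr rfl fun l _ => (hB.pathDiff_row i l).symm

theorem IsASM.sum_Ioi_col (hB : IsASM B) (i k : Fin n) :
    ∑ j ∈ Finset.Ioi i, B j k = 1 - stateValue ((matrixConfig B).1 k i.succ) := by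
  have hc := hB.isConfiguration
  rw [← sum_Ioi_pathDiff (hc.col_first k) (hc.col_last k)]
  exact Finset.sum_congr rfl fun l _ => (hB.pathDiff_col l k).symm

/-- Summing over the position (i, k), `inversions` counts the vertices whose right and lower edges
are both 0. Such a vertex either has all four edges 0 or carries the entry -1. -/
theorem IsASM.inversions_eq (hB : IsASM B) : inversions B =
    ((Finset.univ.filter fun p : Fin n × Fin n => IsEmptyVertex B p.1 p.2).card : ℤ) +
      negOnes B := by
  unfold negOnes
  rw [inversions_eq_sum, Finset.card_filter, Finset.card_filter, Fintype.sum_prod_type,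
    Fintype.sum_prod_type]
  push_cast
  rw [← Finset.sum_add_distrib]
  refine Finset.sum_congr rfl fun i _ => ?_
  rw [← Finset.sum_add_distrib]
  refine Finset.sum_congr rfl fun k _ => ?_
  rw [hB.sum_Ioi_row, hB.sum_Ioi_col]
  have h1 := hB.pathDiff_row i k
  have h2 := hB.pathDiff_col i k
  simp only [pathDiff, IsEmptyVertex] at h1 h2 ⊢
  rcases Bool.dichotomy ((matrixConfig B).2 i k.succ) with ha | ha <;>
  rcases Bool.dichotomy ((matrixConfig B).2 i k.castSucc) with ha' | ha' <;>
  rcases Bool.dichotomy ((matrixConfig B).1 k i.succ) with hb | hb <;>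
  rcases Bool.dichotomy ((matrixConfig B).1 k i.castSucc) with hb' | hb' <;>
  simp only [ha, ha', hb, hb', stateValue, ← h1] at h2 ⊢ <;> simp at h2 ⊢

/-- The predicate that the entry in column `j` of the top row is a `0` to the right of the `1`. -/
def IsTopRightZero [NeZero n] (B : Matrix (Fin n) (Fin n) ℤ) (j : Fin n) : Prop :=
  B 0 j = 0 ∧ (matrixConfig B).2 0 j.succ = true

instance [NeZero n] (j : Fin n) : Decidable (IsTopRightZero B j) := by
  unfold IsTopRightZero; infer_instance

theorem castSucc_zero_of_neZero [NeZero n] : (0 : Fin n).castSucc = 0 := by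
  ext; simp

theorem IsASM.top_row [NeZero n] (hB : IsASM B) (j : Fin n) : B 0 j = 0 ∨ B 0 j = 1 := by
  rw [← hB.pathDiff_col, pathDiff, castSucc_zero_of_neZero, hB.isConfiguration.col_first]
  cases (matrixConfig B).1 j (Fin.succ 0) <;> simp [stateValue]

theorem IsASM.exists_top_one_iff [NeZero n] (hB : IsASM B) (j : Fin n) :
    (∃ k, j < k ∧ B 0 k = 1) ↔ (matrixConfig B).2 0 j.succ = false := by
  have h := hB.sum_Ioi_row 0 j
  constructor
  · rintro ⟨k, hjk, hk⟩
    by_contra hne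
    rw [Bool.not_eq_false] at hne
    rw [hne] at h
    have hle := Finset.single_le_sum (f := B 0) (s := Finset.Ioi j)
      (fun l _ => by rcases hB.top_row l with h | h <;> simp [h])
      (Finset.mem_Ioi.2 hjk)
    rw [h, hk] at hle
    simp [stateValue] at hle
  · intro he
    rw [he] at h
    obtain ⟨k, hk, hk0⟩ := Finset.exists_ne_zero_of_sum_ne_zero
      (h.trans_ne (by simp [stateValue]))
    exact ⟨k, Finset.mem_Ioi.1 hk, (hB.top_row k).resolve_left hk0⟩

theorem IsASM.topZeros_add [NeZero n] (hB : IsASM B) :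
    topZeros B + (Finset.univ.filter fun j => IsTopRightZero B j).card + 1 = n := by
  have h1 : (∑ j, if B 0 j = 1 then 1 else 0 : ℕ) = 1 := by
    have := hB.row_sum 0
    zify
    refine Eq.trans ?_ this
    refine Finset.sum_congr rfl fun j _ => ?_
    rcases hB.top_row j with h | h <;> simp [h]
  unfold topZeros
  trans ∑ j : Fin n, 1
  · rw [Finset.card_filter, Finset.card_filter]
    refine (congrArg (fun a => _ + _ + a) h1.symm).trans ?_
    rw [← Finset.sum_add_distrib, ← Finset.sum_add_distrib]
    refine Finset.sum_congr rfl fun j _ => ?_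
    simp only [hB.exists_top_one_iff, IsTopRightZero]
    rcases hB.top_row j with h | h <;>
      rcases Bool.dichotomy ((matrixConfig B).2 0 j.succ) with h' | h' <;> simp [h, h']
  · simp

theorem prod_prod_ite (P : Fin n → Fin n → Prop) [∀ i j, Decidable (P i j)] (a : R) :
    ∏ i, ∏ j, (if P i j then a else 1) =
      a ^ (Finset.univ.filter fun p : Fin n × Fin n => P p.1 p.2).card := by
  rw [← Fintype.prod_prod_type', Finset.prod_ite]
  simp

/-- With u = 0 the parameter V enters only through the weight a = 1 - V and the weight of an entry
-1. In the top row all upper edges are 0, so no -1 occurs, and the vertices of weight a are the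
zeros to the right of the 1. -/
theorem IsASM.configWeight_eq [NeZero n] (hB : IsASM B) (x y V : R) (i j : Fin n) :
    configWeight x y (fun _ => 0) (fun i => if i = 0 then V else 0) (matrixConfig B) i j =
      (if IsEmptyVertex B i j then y else 1) * (if B i j = -1 then x else 1) *
        (if i = 0 then if IsTopRightZero B j then 1 - V else 1 else 1) := by
  have h1 := hB.pathDiff_row i j
  have h2 := hB.pathDiff_col i j
  by_cases hi : i = 0
  · subst hi
    have h3 := hB.isConfiguration.col_first j
    simp only [pathDiff, IsEmptyVertex, IsTopRightZero, configWeight, castSucc_zero_of_neZero,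
      h3, if_true] at h1 h2 ⊢
    rcases Bool.dichotomy ((matrixConfig B).2 0 j.succ) with ha | ha <;>
    rcases Bool.dichotomy ((matrixConfig B).2 0 j.castSucc) with ha' | ha' <;>
    rcases Bool.dichotomy ((matrixConfig B).1 j (Fin.succ 0)) with hb | hb <;>
    simp only [ha, ha', hb, stateValue, ← h1] at h2 ⊢ <;>
    simp [vertexWeight, aWeight, bWeight] at h2 ⊢
  · simp only [pathDiff, IsEmptyVertex, configWeight, hi, if_false] at h1 h2 ⊢
    rcases Bool.dichotomy ((matrixConfig B).2 i j.succ) with ha | ha <;>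
    rcases Bool.dichotomy ((matrixConfig B).2 i j.castSucc) with ha' | ha' <;>
    rcases Bool.dichotomy ((matrixConfig B).1 j i.succ) with hb | hb <;>
    rcases Bool.dichotomy ((matrixConfig B).1 j i.castSucc) with hb' | hb' <;>
    simp only [ha, ha', hb, hb', stateValue, ← h1] at h2 ⊢ <;>
    simp [vertexWeight, aWeight, bWeight] at h2 ⊢

/-- The partition function of the six-vertex model at the combinatorial point, except for the
parameter of the top row. -/
theorem dwPartition_eq_sum_statistics [NeZero n] (x y V : R) :
    dwPartition x y (fun _ : Fin n => 0) (List.ofFn fun i : Fin n => if i = 0 then V else 0) =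
      ∑ B ∈ asmFinset n, (1 - V) ^ (n - 1 - topZeros B) *
        y ^ (inversions B - (negOnes B : ℤ)).toNat * x ^ negOnes B := by
  rw [dwPartition_eq_sum_asm]
  refine Finset.sum_congr rfl fun B hB => ?_
  replace hB := (mem_asmFinset B).1 hB
  have h1 : (inversions B - (negOnes B : ℤ)).toNat =
      (Finset.univ.filter fun p : Fin n × Fin n => IsEmptyVertex B p.1 p.2).card := by
    rw [hB.inversions_eq]; simp
  have h2 : n - 1 - topZeros B = (Finset.univ.filter fun j => IsTopRightZero B j).card := by
    have := hB.topZeros_add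
    omega
  have h3 : ∏ i : Fin n, ∏ j : Fin n,
      (if i = 0 then if IsTopRightZero B j then 1 - V else 1 else 1) =
        (1 - V) ^ (Finset.univ.filter fun j => IsTopRightZero B j).card := by
    rw [Finset.prod_eq_single 0]
    · simp [Finset.prod_ite]
    · intro i _ hi; simp [hi]
    · simp
  simp only [hB.configWeight_eq, Finset.prod_mul_distrib]
  have h4 : ∏ i, ∏ j, (if B i j = -1 then x else 1) = x ^ negOnes B := by
    exact @prod_prod_ite _ _ _ (fun i j => B i j = -1)
      (fun i j => inferInstanceAs (Decidable (B i j = -1))) x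
  rw [prod_prod_ite, h1, h2, h3, h4]
  ring

end Statistics

/-! ### Columns of a double generating function as series in u -/

section Columns

open PowerSeries

/-- The geometric series `1 / (1 - c u)`. -/
def geom {A : Type*} [CommRing A] (c : A) : PowerSeries A := PowerSeries.mk fun p => c ^ p

theorem geom_mul {A : Type*} [CommRing A] (c : A) : (1 - C c * X) * geom c = 1 := by
  ext i
  rw [sub_mul, one_mul, mul_assoc, map_sub, coeff_C_mul]
  cases i with
  | zero => simp [geom]
  | succ i => simp [geom, coeff_succ_X_mul, coeff_one, pow_succ']

theorem map_geom {A B : Type*} [CommRing A] [CommRing B] (φ : A →+* B) (c : A) :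
    PowerSeries.map φ (geom c) = geom (φ c) := by
  ext i; simp [geom]

variable {K : Type*} [Field K]

/-- The generating function of a column of the matrix with double generating function `f`. -/
noncomputable def column (j : ℕ) (f : MvPowerSeries (Fin 2) K) : PowerSeries K :=
  PowerSeries.mk fun i => matrixOfGenFun f i j

theorem coeff_column (i j : ℕ) (f : MvPowerSeries (Fin 2) K) :
    coeff i (column j f) = matrixOfGenFun f i j := coeff_mk _ _

theorem column_add (j : ℕ) (f g : MvPowerSeries (Fin 2) K) :
    column j (f + g) = column j f + column j g := by
  ext i; simp [column, matrixOfGenFun]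

theorem column_sub (j : ℕ) (f g : MvPowerSeries (Fin 2) K) :
    column j (f - g) = column j f - column j g := by
  ext i; simp [column, matrixOfGenFun]

theorem column_C_mul (j : ℕ) (c : K) (f : MvPowerSeries (Fin 2) K) :
    column j (MvPowerSeries.C c * f) = C c * column j f := by
  ext i; simp [column, matrixOfGenFun, MvPowerSeries.coeff_C_mul]

theorem column_X_zero_mul (j : ℕ) (f : MvPowerSeries (Fin 2) K) :
    column j (MvPowerSeries.X 0 * f) = X * column j f := by
  ext i
  rw [coeff_column, matrixOfGenFun, Matrix.of_apply, MvPowerSeries.X]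
  cases i with
  | zero =>
    rw [MvPowerSeries.coeff_monomial_mul, if_neg, coeff_zero_X_mul]
    intro h
    simpa using h 0
  | succ i =>
    rw [add_comm i, Finsupp.single_add, add_assoc, MvPowerSeries.coeff_add_monomial_mul, one_mul,
      add_comm 1, coeff_succ_X_mul, coeff_column]
    rfl

theorem column_zero_X_one_mul (f : MvPowerSeries (Fin 2) K) :
    column 0 (MvPowerSeries.X 1 * f) = 0 := by
  ext i
  rw [coeff_column, matrixOfGenFun, Matrix.of_apply, MvPowerSeries.X,
    MvPowerSeries.coeff_monomial_mul, if_neg, map_zero]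
  intro h
  simpa using h 1

theorem column_succ_X_one_mul (j : ℕ) (f : MvPowerSeries (Fin 2) K) :
    column (j + 1) (MvPowerSeries.X 1 * f) = column j f := by
  ext i
  rw [coeff_column, coeff_column, matrixOfGenFun, Matrix.of_apply, MvPowerSeries.X,
    add_comm j, Finsupp.single_add, add_left_comm, MvPowerSeries.coeff_add_monomial_mul, one_mul]
  rfl

theorem column_X_one_pow_mul (m j : ℕ) (hj : j ≤ m) (f : MvPowerSeries (Fin 2) K) :
    column j (MvPowerSeries.X 1 ^ m * f) = if j = m then column 0 f else 0 := by
  induction m generalizing j with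
  | zero => obtain rfl : j = 0 := by omega
            simp
  | succ m ih =>
    rw [pow_succ', mul_assoc]
    cases j with
    | zero => rw [column_zero_X_one_mul, if_neg (by omega)]
    | succ j => rw [column_succ_X_one_mul, ih j (by omega)]; simp

/-- The first variable among two variables. -/
def firstEmb : Unit ↪ Fin 2 where
  toFun _ := 0
  inj' _ _ _ := rfl

theorem column_zero_eq (f : MvPowerSeries (Fin 2) K) :
    column 0 f = MvPowerSeries.killCompl (R := K) firstEmb f := by
  ext i
  rw [coeff_column, PowerSeries.coeff, MvPowerSeries.coeff_killCompl, Finsupp.embDomain_single]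
  simp only [matrixOfGenFun, Matrix.of_apply, Finsupp.single_zero, add_zero]
  rfl

theorem column_zero_one : column 0 (1 : MvPowerSeries (Fin 2) K) = 1 := by
  rw [column_zero_eq, map_one]

theorem column_succ_one (j : ℕ) : column (j + 1) (1 : MvPowerSeries (Fin 2) K) = 0 := by
  classical
  ext i
  rw [coeff_column, matrixOfGenFun, Matrix.of_apply, MvPowerSeries.coeff_one, if_neg, map_zero]
  intro h
  simpa using DFunLike.congr_fun h 1

/-- The ratio of consecutive columns. -/
noncomputable def columnRatio (x y : K) : PowerSeries K := 1 + C y * X * geom x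

theorem mul_columnRatio (x y : K) : (1 - C x * X) * columnRatio x y = 1 + C (y - x) * X := by
  rw [columnRatio, map_sub]
  linear_combination C y * X * geom_mul x

theorem eq_mul_geom {x : K} {f g : PowerSeries K} (h : (1 - C x * X) * f = g) :
    f = g * geom x := by
  linear_combination (-f) * geom_mul x + geom x * h

theorem column_inv_one_sub (j : ℕ) :
    column j (1 - MvPowerSeries.X 0 * MvPowerSeries.X 1 : MvPowerSeries (Fin 2) K)⁻¹ = X ^ j := by
  have h := MvPowerSeries.mul_inv_cancel
    (1 - MvPowerSeries.X 0 * MvPowerSeries.X 1 : MvPowerSeries (Fin 2) K) (by simp)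
  set f := (1 - MvPowerSeries.X 0 * MvPowerSeries.X 1 : MvPowerSeries (Fin 2) K)⁻¹
  rw [sub_mul, one_mul, mul_assoc] at h
  induction j with
  | zero =>
    have := congrArg (column 0) h
    rw [column_sub, column_X_zero_mul, column_zero_X_one_mul, column_zero_one] at this
    simpa using this
  | succ j ih =>
    have := congrArg (column (j + 1)) h
    rw [column_sub, column_X_zero_mul, column_succ_X_one_mul, column_succ_one, ih] at this
    rw [sub_eq_zero.1 this, pow_succ']

/-- Since a = (1 - x u)(1 - ρ v) with ρ = `columnRatio x y`, the expansion of 1/a in v is geometric.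
-/
theorem column_inv_aWeight (x y : K) (j : ℕ) :
    column j (1 - MvPowerSeries.C x * MvPowerSeries.X 0 - MvPowerSeries.X 1 -
      MvPowerSeries.C (y - x) * MvPowerSeries.X 0 * MvPowerSeries.X 1 :
        MvPowerSeries (Fin 2) K)⁻¹ = columnRatio x y ^ j * geom x := by
  have h := MvPowerSeries.mul_inv_cancel (1 - MvPowerSeries.C x * MvPowerSeries.X 0 -
      MvPowerSeries.X 1 - MvPowerSeries.C (y - x) * MvPowerSeries.X 0 * MvPowerSeries.X 1 :
        MvPowerSeries (Fin 2) K) (by simp)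
  set f := (1 - MvPowerSeries.C x * MvPowerSeries.X 0 - MvPowerSeries.X 1 -
      MvPowerSeries.C (y - x) * MvPowerSeries.X 0 * MvPowerSeries.X 1 :
        MvPowerSeries (Fin 2) K)⁻¹
  simp only [sub_mul, one_mul, mul_assoc] at h
  have hr := mul_columnRatio x y
  induction j with
  | zero =>
    have := congrArg (column 0) h
    simp only [column_sub, column_C_mul, column_X_zero_mul, column_zero_X_one_mul,
      column_zero_one] at this
    rw [pow_zero]
    exact eq_mul_geom (by linear_combination this)
  | succ j ih =>
    have := congrArg (column (j + 1)) h
    simp only [column_sub, column_C_mul, column_X_zero_mul, column_succ_X_one_mul,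
      column_succ_one, ih] at this
    refine eq_mul_geom ?_
    have hg := geom_mul x
    rw [pow_succ]
    linear_combination this - columnRatio x y ^ j * geom x * hr +
      columnRatio x y ^ j * columnRatio x y * hg

theorem column_baseGenFun (x y ν : K) (j : ℕ) :
    column j (baseGenFun x y ν) =
      C (1 - ν) * X ^ j + C ν * (columnRatio x y ^ j * geom x) := by
  rw [baseGenFun, column_add, column_C_mul, column_C_mul, column_inv_one_sub, column_inv_aWeight]

theorem column_modifiedGenFun (m : ℕ) (x y z ν : K) (j : ℕ) (hj : j ≤ m) :
    column j (modifiedGenFun (m + 1) x y z ν) = column j (baseGenFun x y ν) +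
      if j = m then C (ν * (z - 1)) * geom (y * (z - 1) + x) * columnRatio x y ^ (m + 1)
      else 0 := by
  have hinv : ∀ c : K, MvPowerSeries.killCompl (R := K) firstEmb
      (1 - MvPowerSeries.C c * MvPowerSeries.X 0)⁻¹ = geom c := by
    intro c
    have h := congrArg (MvPowerSeries.killCompl (R := K) firstEmb) (MvPowerSeries.mul_inv_cancel
      (1 - MvPowerSeries.C c * MvPowerSeries.X 0 : MvPowerSeries (Fin 2) K) (by simp))
    rw [map_mul, map_sub, map_mul, map_one, MvPowerSeries.killCompl_C,
      show (0 : Fin 2) = firstEmb () from rfl, MvPowerSeries.killCompl_X] at h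
    exact (eq_mul_geom h).trans (one_mul _)
  have h1 : MvPowerSeries.killCompl (R := K) firstEmb (MvPowerSeries.X 1) = 0 :=
    MvPowerSeries.killCompl_X_eq_zero (by rintro ⟨_, h⟩; exact zero_ne_one h)
  have h0 : MvPowerSeries.killCompl (R := K) firstEmb (MvPowerSeries.X 0) = X :=
    MvPowerSeries.killCompl_X (e := firstEmb) ()
  have hC : ∀ c : K, MvPowerSeries.killCompl (R := K) firstEmb (MvPowerSeries.C c) = C c :=
    fun c => MvPowerSeries.killCompl_C c
  rw [modifiedGenFun, column_add]
  congr 1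
  simp only [Nat.add_sub_cancel]
  -- The factor v^m leaves only column m, where the remaining factor is taken at v = 0. There the
  -- last parenthesis of the generating function becomes 1.
  rw [mul_right_comm _ (MvPowerSeries.X 1 ^ m), mul_comm _ (MvPowerSeries.X 1 ^ m),
    column_X_one_pow_mul m j hj, column_zero_eq, map_mul, map_mul, map_mul, map_pow, hC, hinv]
  simp only [map_mul, map_add, map_one, h1, hinv, h0, hC, zero_mul, add_zero, mul_one]
  rfl

end Columns

/-! ### The substitution z = 1/(1-V) and arbitrary z -/

section Refinement

open PowerSeries

variable {K : Type*} [Field K]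

/-- The sum of `z^t(B) y^(Inv(B) - N(B)) x^N(B)` over alternating sign matrices `B`, in a
commutative ring. -/
def refinedSum {A : Type*} [CommRing A] (n : ℕ) [NeZero n] (x y z : A) : A :=
  ∑ B ∈ asmFinset n,
    z ^ topZeros B * y ^ (inversions B - (negOnes B : ℤ)).toNat * x ^ negOnes B

theorem map_refinedSum {A A' : Type*} [CommRing A] [CommRing A'] (ψ : A →+* A') (n : ℕ) [NeZero n]
    (x y z : A) : ψ (refinedSum n x y z) = refinedSum n (ψ x) (ψ y) (ψ z) := by
  simp [refinedSum]

/-- The truncated modified matrix, with the refinement parameter `z` in a ring `A` over `K`. -/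
noncomputable def refinedMatrix {A : Type*} [CommRing A] (φ : K →+* A) (m : ℕ) (x y ν : K) (z : A) :
    Matrix (Fin (m + 1)) (Fin (m + 1)) A :=
  Matrix.of fun i j => φ (matrixOfGenFun (baseGenFun x y ν) i j) +
    if j = Fin.last m then coeff (i : ℕ) (C (φ ν * (z - 1)) * geom (φ y * (z - 1) + φ x) *
      PowerSeries.map φ (columnRatio x y) ^ (m + 1)) else 0

theorem map_refinedMatrix {A A' : Type*} [CommRing A] [CommRing A'] (φ : K →+* A) (ψ : A →+* A')
    (m : ℕ) (x y ν : K) (z : A) :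
    ψ.mapMatrix (refinedMatrix φ m x y ν z) = refinedMatrix (ψ.comp φ) m x y ν (ψ z) := by
  ext i j
  simp only [RingHom.mapMatrix_apply, Matrix.map_apply, refinedMatrix, Matrix.of_apply, map_add,
    RingHom.comp_apply]
  congr 1
  split_ifs with h
  · rw [← PowerSeries.coeff_map]
    have hm : PowerSeries.map ψ (PowerSeries.map φ (columnRatio x y)) =
        PowerSeries.map (ψ.comp φ) (columnRatio x y) := by ext; simp
    simp only [map_mul, map_pow, map_geom, PowerSeries.map_C, map_sub, map_add, map_one, hm]
  · exact map_zero ψ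

theorem truncation_modifiedMatrix (m : ℕ) (x y z ν : K) :
    truncation (m + 1) (modifiedMatrix (m + 1) x y z ν) =
      refinedMatrix (RingHom.id K) m x y ν z := by
  ext i j
  have h := congrArg (coeff (i : ℕ))
    (column_modifiedGenFun m x y z ν j (Nat.lt_succ_iff.1 j.isLt))
  rw [coeff_column, map_add, coeff_column] at h
  simp only [truncation, modifiedMatrix, refinedMatrix, Matrix.of_apply, h, Fin.ext_iff,
    Fin.val_last, RingHom.id_apply, PowerSeries.map_id]
  congr 1
  split_ifs <;> simp

/-- Summation of a geometric progression of power series, with respect to a new variable. -/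
theorem mk_mk_coeff_mul (p q : PowerSeries K) :
    (PowerSeries.mk fun i => PowerSeries.mk fun l => coeff i (p * q ^ l)) =
      PowerSeries.map (C (R := K)) p + C (X : PowerSeries K) * (PowerSeries.map (C (R := K)) q *
        PowerSeries.mk fun i => PowerSeries.mk fun l => coeff i (p * q ^ l)) := by
  ext i l
  rw [map_add, map_add, coeff_C_mul, coeff_mk, coeff_mk, PowerSeries.coeff_map]
  cases l with
  | zero => simp
  | succ l =>
    rw [coeff_succ_X_mul, coeff_C, if_neg (Nat.succ_ne_zero l), zero_add,
      show p * q ^ (l + 1) = q * (p * q ^ l) by ring, coeff_mul, coeff_mul, map_sum]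
    refine Finset.sum_congr rfl fun a _ => ?_
    rw [PowerSeries.coeff_map, coeff_C_mul, coeff_mk, coeff_mk]

/-- The series `1 / (1 - V)`. -/
def unitGeom (K : Type*) [Field K] : PowerSeries K := geom 1

theorem one_sub_mul_unitGeom : (1 - X) * unitGeom K = 1 := by
  simpa [unitGeom] using geom_mul (1 : K)

/-- This evaluates ∑ V^(l+1) ρ^(m+1+l)/(1 - x u) over l ≥ 0 as a closed form in z = 1/(1-V), which
is the extra column of the modified matrix without its factor ν. -/
theorem X_mul_mk_mk_coeff (x y : K) (m : ℕ) :
    C (X : PowerSeries K) * (PowerSeries.mk fun i => PowerSeries.mk fun l =>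
        coeff i (columnRatio x y ^ (m + 1) * geom x * columnRatio x y ^ l)) =
      C (unitGeom K - 1) * geom (C y * (unitGeom K - 1) + C x) *
        PowerSeries.map (C (R := K)) (columnRatio x y) ^ (m + 1) := by
  have hF := mk_mk_coeff_mul (columnRatio x y ^ (m + 1) * geom x) (columnRatio x y)
  set F := PowerSeries.mk fun i => PowerSeries.mk fun l =>
        coeff i (columnRatio x y ^ (m + 1) * geom x * columnRatio x y ^ l)
  rw [map_mul, map_pow, map_geom] at hF
  have hρ := congrArg (PowerSeries.map (C (R := K))) (mul_columnRatio x y)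
  simp only [map_mul, map_sub, map_add, map_one, PowerSeries.map_C, PowerSeries.map_X] at hρ
  set ρ := PowerSeries.map (C (R := K)) (columnRatio x y)
  have hx := geom_mul (C x : PowerSeries K)
  have hc := geom_mul (C y * (unitGeom K - 1) + C x : PowerSeries K)
  have hz := congrArg (C (R := PowerSeries K)) (one_sub_mul_unitGeom (K := K))
  simp only [map_mul, map_sub, map_add, map_one] at hc hz ⊢
  set g := geom (C y * (unitGeom K - 1) + C x : PowerSeries K)
  set V : PowerSeries (PowerSeries K) := C (X : PowerSeries K)
  set Z : PowerSeries (PowerSeries K) := C (unitGeom K)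
  set U : PowerSeries (PowerSeries K) := X
  set cx : PowerSeries (PowerSeries K) := C (C x)
  set cy : PowerSeries (PowerSeries K) := C (C y)
  -- The geometric series with its denominator cleared; `h2` rewrites this denominator, multiplied
  -- by z, as 1 - (y(z-1) + x)u, and V z = z - 1.
  have h1 : ((1 - cx * U) - V * (1 + (cy - cx) * U)) * F = ρ ^ (m + 1) := by
    linear_combination (1 - cx * U) * hF + ρ ^ (m + 1) * hx + V * F * hρ
  have h2 : Z * ((1 - cx * U) - V * (1 + (cy - cx) * U)) = 1 - (cy * (Z - 1) + cx) * U := by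
    linear_combination (1 - cx * U + cy * U) * hz
  linear_combination V * Z * g * h1 - V * g * F * h2 - V * F * hc +
    (-(g * ρ ^ (m + 1))) * hz

theorem mk_base_eq (x y ν : K) (m i : ℕ) (hi : i ≤ m) :
    (PowerSeries.mk fun l => matrixOfGenFun (baseGenFun x y ν) i (m + l)) =
      C (matrixOfGenFun (baseGenFun x y ν) i m) +
        coeff i (C (C ν * (unitGeom K - 1)) * geom (C y * (unitGeom K - 1) + C x) *
          PowerSeries.map (C (R := K)) (columnRatio x y) ^ (m + 1)) := by
  rw [map_mul C (C ν), mul_assoc (C (C ν)), mul_assoc (C (C ν)), coeff_C_mul, ← X_mul_mk_mk_coeff,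
    coeff_C_mul, coeff_mk]
  ext l
  rw [coeff_mk, map_add, coeff_C_mul]
  cases l with
  | zero => simp
  | succ l =>
    -- The part (1-ν)u^j of column j = m + l + 1 is invisible in the rows i ≤ m, so only the
    -- geometric part remains.
    rw [coeff_succ_X_mul, coeff_mk, coeff_C, if_neg (Nat.succ_ne_zero l), zero_add, ← coeff_column,
      column_baseGenFun, map_add, coeff_C_mul, coeff_C_mul, coeff_X_pow, if_neg (by omega),
      mul_zero, zero_add]
    congr 2
    ring

/-- Only the last column depends on V, so Laplace expansion along it reduces the claim to its
entries, which are the series of `mk_base_eq`. -/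
theorem coeff_det_refinedMatrix (x y ν : K) (m l : ℕ) :
    coeff l (refinedMatrix C m x y ν (unitGeom K)).det = (Matrix.of fun i j : Fin (m + 1) =>
      matrixOfGenFun (baseGenFun x y ν) i ((j : ℕ) + if j = Fin.last m then l else 0)).det := by
  rw [Matrix.det_succ_column _ (Fin.last m), Matrix.det_succ_column _ (Fin.last m), map_sum]
  refine Finset.sum_congr rfl fun i _ => ?_
  have h1 : refinedMatrix C m x y ν (unitGeom K) i (Fin.last m) =
      PowerSeries.mk fun l => matrixOfGenFun (baseGenFun x y ν) i (m + l) := by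
    rw [mk_base_eq x y ν m i (Nat.lt_succ_iff.1 i.isLt), refinedMatrix, Matrix.of_apply, if_pos rfl,
      Fin.val_last]
  have h2 : (refinedMatrix C m x y ν (unitGeom K)).submatrix i.succAbove (Fin.last m).succAbove =
      (C (R := K)).mapMatrix ((Matrix.of fun i j : Fin (m + 1) =>
        matrixOfGenFun (baseGenFun x y ν) i ((j : ℕ) + if j = Fin.last m then l else 0)).submatrix
          i.succAbove (Fin.last m).succAbove) := by
    ext1 a b
    simp [refinedMatrix, (Fin.castSucc_lt_last b).ne]
  have h3 : ((-1 : PowerSeries K) ^ ((i : ℕ) + (Fin.last m : Fin (m + 1)))) =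
      C ((-1) ^ ((i : ℕ) + (Fin.last m : Fin (m + 1)))) := by simp
  rw [h1, h2, h3, ← RingHom.map_det, coeff_mul_C, coeff_C_mul, coeff_mk, Matrix.of_apply,
    if_pos rfl, Fin.val_last]

theorem refined_unitGeom {x y ν : K} (hx : x ≠ 0) (h : x * ν * (1 - ν) = ν + y * (1 - ν)) (m : ℕ) :
    (1 + C ν * (unitGeom K - 1)) * refinedSum (m + 1) (C x) (C y) (unitGeom K) =
      (refinedMatrix C m x y ν (unitGeom K)).det := by
  obtain ⟨G, hG, hdet⟩ := exists_powerSeries_coeff_eq_det hx h m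
  have hGdet : G = (refinedMatrix C m x y ν (unitGeom K)).det := by
    ext l; rw [hdet, coeff_det_refinedMatrix]
  -- The coefficient extraction puts V in the last row, the statistic t(B) needs it in the top row;
  -- symmetry in the row parameters moves it.
  have hperm : dwPartition (C x) (C y) (fun _ : Fin (m + 1) => (0 : PowerSeries K))
      (List.ofFn fun j : Fin (m + 1) => if j = Fin.last m then X else 0) =
      dwPartition (C x) (C y) (fun _ : Fin (m + 1) => (0 : PowerSeries K))
        (List.ofFn fun j : Fin (m + 1) => if j = 0 then X else 0) := by
    refine dwPartition_perm _ _ _ ?_ ?_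
    · have := (Fin.revPerm (n := m + 1)).ofFn_comp_perm
        fun j : Fin (m + 1) => if j = 0 then (X : PowerSeries K) else 0
      convert this using 3 with j
      simp [← Fin.rev_last, Fin.rev_inj]
    · rw [List.pairwise_ofFn]
      intro i j _ h0
      have h1 := congrArg (constantCoeff (R := K)) h0
      refine hx ?_
      split_ifs at h1 <;> simpa using h1
  rw [hperm, dwPartition_eq_sum_statistics] at hG
  have hZ := one_sub_mul_unitGeom (K := K)
  -- The power z^m turns (1-V)^(m-t) into z^t.
  have hsum : unitGeom K ^ m * (∑ B ∈ asmFinset (m + 1), (1 - X) ^ (m + 1 - 1 - topZeros B) *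
        C y ^ (inversions B - (negOnes B : ℤ)).toNat * C x ^ negOnes B) =
      refinedSum (m + 1) (C x) (C y) (unitGeom K) := by
    rw [refinedSum, Finset.mul_sum]
    refine Finset.sum_congr rfl fun B hB => ?_
    have ht := ((mem_asmFinset B).1 hB).topZeros_add
    obtain ⟨d, hd⟩ : ∃ d, m = topZeros B + d := ⟨m - topZeros B, by omega⟩
    rw [show m + 1 - 1 - topZeros B = d by omega, ← mul_assoc, ← mul_assoc]
    congr 2
    nth_rewrite 1 [hd]
    rw [pow_add, mul_assoc, ← mul_pow, mul_comm (unitGeom K) (1 - X), hZ, one_pow, mul_one]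
  have hpow : (1 - X) ^ (m + 1) * unitGeom K ^ (m + 1) = 1 := by rw [← mul_pow, hZ, one_pow]
  rw [← hGdet, ← hsum]
  have hC : C (1 - ν) = 1 - (C ν : PowerSeries K) := by simp
  rw [hC] at hG
  set S := ∑ B ∈ asmFinset (m + 1), (1 - (X : PowerSeries K)) ^ (m + 1 - 1 - topZeros B) *
        C y ^ (inversions B - (negOnes B : ℤ)).toNat * C x ^ negOnes B
  have hpow' : unitGeom K ^ (m + 1) = unitGeom K ^ m * unitGeom K := pow_succ _ _
  rw [hpow'] at hpow
  -- Multiply `hG` by z^(m+1), and use z(1 - (1-ν)V) = 1 + ν(z-1).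
  linear_combination (-(unitGeom K ^ m * unitGeom K)) * hG + G * hpow +
    (-(unitGeom K ^ m * S * (1 - C ν))) * hZ

/-- An algebraic relation for 1/(1-V) gives, by reversing the polynomial, one for 1 - V. The
substitution of 1 - V for V is an involution of K[V], so the reversed polynomial vanishes. -/
theorem eq_zero_of_eval₂_unitGeom (p : Polynomial K)
    (h : p.eval₂ (C (R := K)) (unitGeom K) = 0) : p = 0 := by
  let _ : Invertible (unitGeom K) := ⟨1 - X, one_sub_mul_unitGeom, by
    rw [mul_comm]; exact one_sub_mul_unitGeom⟩
  have h1 := Polynomial.eval₂_reverse_mul_pow (C (R := K)) (unitGeom K) p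
  rw [h] at h1
  have h2 : p.reverse.eval₂ (C (R := K)) (1 - X) = 0 := by
    have hu : IsUnit (unitGeom K ^ p.natDegree) := (isUnit_of_invertible _).pow _
    exact hu.mul_left_eq_zero.1 h1
  have h3 : ((p.reverse.comp (1 - Polynomial.X) : Polynomial K) : PowerSeries K) = 0 := by
    rw [← h2, Polynomial.comp, ← Polynomial.coeToPowerSeries.ringHom_apply,
      Polynomial.hom_eval₂]
    congr 1
    · ext; simp
    · simp
  rw [Polynomial.coe_eq_zero_iff] at h3
  have h4 : (p.reverse.comp (1 - Polynomial.X)).comp (1 - Polynomial.X) = p.reverse := by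
    rw [Polynomial.comp_assoc]; simp
  rw [h3, Polynomial.zero_comp] at h4
  exact Polynomial.reverse_eq_zero.1 h4.symm

/-- The difference of the two sides is a polynomial in z over K that vanishes at the transcendental
element 1/(1-V). It is therefore zero and may be evaluated at any z. -/
theorem refined_formula {x y ν : K} (hx : x ≠ 0) (h : x * ν * (1 - ν) = ν + y * (1 - ν)) (m : ℕ)
    (z : K) :
    (1 + ν * (z - 1)) * refinedSum (m + 1) x y z =
      (refinedMatrix (RingHom.id K) m x y ν z).det := by
  set p : Polynomial K := (1 + Polynomial.C ν * (Polynomial.X - 1)) *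
    refinedSum (m + 1) (Polynomial.C x) (Polynomial.C y) Polynomial.X -
      (refinedMatrix Polynomial.C m x y ν Polynomial.X).det with hp
  have hp0 : p = 0 := by
    refine eq_zero_of_eval₂_unitGeom p ?_
    rw [← Polynomial.coe_eval₂RingHom, hp, map_sub, map_mul, map_refinedSum, RingHom.map_det,
      map_refinedMatrix]
    have hc : (Polynomial.eval₂RingHom (C (R := K)) (unitGeom K)).comp Polynomial.C = C := by
      ext; simp
    rw [hc]
    simp only [Polynomial.coe_eval₂RingHom, Polynomial.eval₂_add, Polynomial.eval₂_mul,
      Polynomial.eval₂_sub, Polynomial.eval₂_one, Polynomial.eval₂_C, Polynomial.eval₂_X]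
    rw [refined_unitGeom hx h, sub_self]
  have h1 := congrArg (Polynomial.evalRingHom z) hp0
  rw [hp, map_sub, map_mul, map_refinedSum, RingHom.map_det, map_refinedMatrix, map_zero] at h1
  have hc : (Polynomial.evalRingHom z).comp Polynomial.C = RingHom.id K := by
    ext; simp
  rw [hc] at h1
  simpa [sub_eq_zero] using h1

end Refinement

end RefinedASM

theorem mainTheorem4 {K : Type*} [Field K] (n : ℕ) [NeZero n] (x y z ν : K)
    (hx : x ≠ 0) (hν : ν ≠ 0) (hxyν : x * ν * (1 - ν) = ν + y * (1 - ν)) :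
    (1 + ν * (z - 1)) * RefinedASM.partitionFunction n x y z =
      (RefinedASM.truncation n (RefinedASM.modifiedMatrix n x y z ν)).det := by
  obtain ⟨m, rfl⟩ := Nat.exists_eq_succ_of_ne_zero (NeZero.ne n)
  rw [RefinedASM.truncation_modifiedMatrix]
  exact RefinedASM.refined_formula hx hxyν m z
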